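/- Let $X_0(x)=\frac52+\sum_{k\ge1}\alpha_kx^{2k}$ with $\alpha_1=1$ and $2(k+1)(4k^2+\frac54)\alpha_{k+1}+(2k-1)\alpha_k=0$ for $k\ge1$ (an entire series), and on $D=\{(x,y)\in\mathbb R^2: x>0\}$ put $h(x,y)=2X_0-xX_0'+y^2X_0'/x+\sqrt5$ and $$a_1=\tfrac{2y}{xh}\bigl(X_0+\tfrac{\sqrt5}2\bigr),\quad b_1=-\tfrac1{xh}\bigl(X_0+\tfrac{\sqrt5}2+\sqrt5(x^2-y^2)\bigr),\quad c_1=-\tfrac2{xh}\bigl(X_0+\tfrac{\sqrt5}2\bigr),$$ $$a_2=-\tfrac1h\bigl(2X_0+\sqrt5-(x^2+y^2)\tfrac{X_0'}x\bigr),\quad b_2=-\tfrac{2y}h\bigl(\tfrac{X_0'}{2x}+\sqrt5\bigr),\quad c_2=\tfrac{2y}h\bigl(X_0''-\tfrac{X_0'}x\bigr)$$ A curvature surface on $D$ is a map $f^0:D\to\mathbb R^4$ with an orthonormal frame field $F^0=[\phi,X^0_\alpha,X^0_\beta,\xi]$ of $\mathbb R^4$ on $D$ such that $$d\phi=-a_1X^0_\alpha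 dx-a_2X^0_\beta dy,\qquad dX^0_\alpha=(a_1\phi-c_1X^0_\beta-b_1\xi)dx+c_2X^0_\beta dy,$$ $$dX^0_\beta=c_1X^0_\alpha dx+(a_2\phi-c_2X^0_\alpha-b_2\xi)dy,\qquad d\xi=b_1X^0_\alpha dx+b_2X^0_\beta dy,$$ $$df^0=\frac{x^2-y^2}{xh}X^0_\alpha\,dx+\frac{2y}{h}X^0_\beta\,dy .$$ Put $\mathbf n(x,y)=(1+y^2)^{-1/2}(X^0_\beta+y\phi)(x,y)$, $R(y)=\frac1{2\sqrt5}\sqrt{\frac{5+4y^2}{1+y^2}}$, and $w(x)=\sqrt5\int_0^x\frac{t}{2X_0(t)-tX_0'(t)}\,dt$. **Theorem.** For every curvature surface $f^0$ on $D$ with frame field $F^0$ there are functions $\mathbf u,\mathbf v_1,A:\mathbb R\to\mathbb R^4$ and vectors $\mathbf b^\infty,\mathbf c^\infty\in\mathbb R^4$, determined by the following conditions. For all $x>0$ and all $y$, $\mathbf u(y)=(1+y^2)^{-1/2}(yX^0_\beta-\phi)(x,y)$. The function $\mathbf v_1$ is continuous and $\mathbf u'(y)=\frac{y^2}{1+y^2}\mathbf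 v_1(y)$. For all $x>0$ and all $y$, $f^0(x,y)=R(y)\,\mathbf f(x,y)+A(y)$ with $\mathbf f=((1+y^2)(5+4y^2))^{-1/2}(X^0_\beta-2(1+y^2)\xi+y\phi)$, so that the curve $x\mapsto f^0(x,y)$ lies on the 2-sphere $\mathbb S^2_y$ with centre $A(y)$ and radius $R(y)$ in the affine hyperplane through $A(y)$ perpendicular to $\mathbf u(y)$. The vectors $\mathbf u(y),\mathbf v_1(y),\mathbf b^\infty,\mathbf c^\infty$ are orthonormal for every $y$, and $X^0_\alpha(e^{-s},y)-\bigl(\cos\frac{\sqrt5s}2\,\mathbf b^\infty-\sin\frac{\sqrt5s}2\,\mathbf c^\infty\bigr)\to0$ as $s\to\infty$, uniformly in $y\in\mathbb R$. For these objects the following holds. 1. For each $y\in\mathbb R$ the curve $x\mapsto\mathbf n(x,y)$, $x\in[1,\infty)$, has infinite length, and $\mathbf n(x,y)\to-\mathbf v_1(y)$ as $x\to\infty$. It winds uniformly around $-\mathbf v_1(y)$: there are constants $0<m\le M$, independent of $y$, and for each $y$ functions $l,r,\theta$ with $r>0$, $$\mathbf n(x,y)=-l(x)\mathbf v_1(y)+r(x)\bigl(\cos\theta(x)\,\mathbf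 b^\infty+\sin\theta(x)\,\mathbf c^\infty\bigr)\quad(x\ge1),$$ and $m(x'-x)\le\theta(x')-\theta(x)\le M(x'-x)$ for $1\le x\le x'$. Moreover $\mathbf n(x,y)\ne-\mathbf v_1(y)$ for all $x>0$. 2. There is an orthonormal basis $[\hat{\mathbf b},\hat{\mathbf c}]$ of the plane spanned by $\mathbf b^\infty,\mathbf c^\infty$ (independent of $x$ and $y$) such that, with $\bar{\mathbf b}(x)=\cos w(x)\,\hat{\mathbf b}-\sin w(x)\,\hat{\mathbf c}$ and $\bar{\mathbf c}(x)=\sin w(x)\,\hat{\mathbf b}+\cos w(x)\,\hat{\mathbf c}$, we have $\xi(x,y)-\bar{\mathbf b}(x)\to0$ and $X^0_\alpha(x,y)-\bar{\mathbf c}(x)\to0$ as $x\to\infty$, uniformly for $y$ in compact subsets of $\mathbb R$. 3. The points $$\gamma(x,y)=-\frac{1}{2\sqrt5\,(1+y^2)^{1/2}}\Bigl(\mathbf v_1(y)+2(1+y^2)^{1/2}\,\bar{\mathbf b}(x)\Bigr)+A(y)$$ lie on $\mathbb S^2_y$, and $f^0(x,y)-\gamma(x,y)\to0$ as $x\to\infty$,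 uniformly for $y$ in compact subsets of $\mathbb R$. -/

import Mathlib

open scoped Topology
open Filter

namespace ConfFlat

/-- Euclidean four-space. -/
abbrev E4 : Type := EuclideanSpace ℝ (Fin 4)

/-- The coefficients of `X₀`: the constant term `5/2`, then `a₁ = 1` and
`2(k+1)(4k²+5/4) a_{k+1} + (2k-1) a_k = 0` for `k ≥ 1`. -/
noncomputable def coeffX : ℕ → ℝ
  | 0 => 5 / 2
  | 1 => 1
  | (k + 2) =>
      -((2 * ((k : ℝ) + 1) - 1) / (2 * ((k : ℝ) + 2) * (4 * ((k : ℝ) + 1) ^ 2 + 5 / 4)))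
        * coeffX (k + 1)

/-- `X₀(x) = 5/2 + ∑_{k ≥ 1} a_k x^{2k}`, a power series with infinite radius of convergence. -/
noncomputable def X0 (x : ℝ) : ℝ := ∑' k : ℕ, coeffX k * x ^ (2 * k)

/-- `X₀'` -/
noncomputable def dX0 (x : ℝ) : ℝ := deriv X0 x

/-- `X₀''` -/
noncomputable def ddX0 (x : ℝ) : ℝ := deriv dX0 x

/-- The half plane `D = {(x, y) | x > 0}`. -/
def D : Set (ℝ × ℝ) := {p | 0 < p.1}

/-- `h(x, y) = 2 X₀ - x X₀' + y² X₀' / x + √5` -/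
noncomputable def h (x y : ℝ) : ℝ :=
  2 * X0 x - x * dX0 x + y ^ 2 * (dX0 x / x) + √5

noncomputable def a₁ (x y : ℝ) : ℝ := 2 * y / (x * h x y) * (X0 x + √5 / 2)

noncomputable def b₁ (x y : ℝ) : ℝ :=
  -1 / (x * h x y) * (X0 x + √5 / 2 + √5 * (x ^ 2 - y ^ 2))

noncomputable def c₁ (x y : ℝ) : ℝ := -2 / (x * h x y) * (X0 x + √5 / 2)

noncomputable def a₂ (x y : ℝ) : ℝ :=
  -1 / h x y * (2 * X0 x + √5 - (x ^ 2 + y ^ 2) * (dX0 x / x))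

noncomputable def b₂ (x y : ℝ) : ℝ := -2 * y / h x y * (dX0 x / (2 * x) + √5)

noncomputable def c₂ (x y : ℝ) : ℝ := 2 * y / h x y * (ddX0 x - dX0 x / x)

/-- The `dx`-part of the connection form `Ω = Ω₁ dx + Ω₂ dy`. -/
noncomputable def Ω₁ (x y : ℝ) : Matrix (Fin 4) (Fin 4) ℝ :=
  !![0, a₁ x y, 0, 0;
     -a₁ x y, 0, c₁ x y, b₁ x y;
     0, -c₁ x y, 0, 0;
     0, -b₁ x y, 0, 0]

/-- The `dy`-part of the connection form `Ω = Ω₁ dx + Ω₂ dy`. -/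
noncomputable def Ω₂ (x y : ℝ) : Matrix (Fin 4) (Fin 4) ℝ :=
  !![0, 0, a₂ x y, 0;
     0, 0, -c₂ x y, 0;
     -a₂ x y, c₂ x y, 0, b₂ x y;
     0, 0, -b₂ x y, 0]

/-- A curvature surface `f⁰` on `D` together with the orthonormal frame field
`F⁰ = [φ, X⁰_α, X⁰_β, ξ]` (the columns `F 0, F 1, F 2, F 3`) determining it:
`dF⁰ = F⁰ Ω`, that is `dF_j = ∑ i, F_i (Ω₁)_{ij} dx + F_i (Ω₂)_{ij} dy`, and
`df⁰ = (x² - y²) / (x h) dx X⁰_α + 2 y / h dy X⁰_β` on `D`. -/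
structure CurvatureSurface where
  f : ℝ × ℝ → E4
  F : Fin 4 → ℝ × ℝ → E4
  orthonormal : ∀ p ∈ D, Orthonormal ℝ (fun j => F j p)
  dF : ∀ p ∈ D, ∀ j : Fin 4,
    HasFDerivAt (F j)
      ((ContinuousLinearMap.fst ℝ ℝ ℝ).smulRight (∑ i, Ω₁ p.1 p.2 i j • F i p) +
        (ContinuousLinearMap.snd ℝ ℝ ℝ).smulRight (∑ i, Ω₂ p.1 p.2 i j • F i p)) p
  df : ∀ p ∈ D,
    HasFDerivAt f
      ((ContinuousLinearMap.fst ℝ ℝ ℝ).smulRight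
          (((p.1 ^ 2 - p.2 ^ 2) / (p.1 * h p.1 p.2)) • F 1 p) +
        (ContinuousLinearMap.snd ℝ ℝ ℝ).smulRight ((2 * p.2 / h p.1 p.2) • F 2 p)) p

namespace CurvatureSurface

variable (S : CurvatureSurface)

/-- `φ` -/
def φ (x y : ℝ) : E4 := S.F 0 (x, y)

/-- `X⁰_α` -/
def Xα (x y : ℝ) : E4 := S.F 1 (x, y)

/-- `X⁰_β` -/
def Xβ (x y : ℝ) : E4 := S.F 2 (x, y)

/-- `ξ` -/
def ξ (x y : ℝ) : E4 := S.F 3 (x, y)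

/-- `n(x, y) = (1 + y²)^{-1/2} (X⁰_β + y φ)(x, y)` -/
noncomputable def n (x y : ℝ) : E4 := (√(1 + y ^ 2))⁻¹ • (S.Xβ x y + y • S.φ x y)

/-- `𝐟(x, y) = ((1 + y²)(5 + 4y²))^{-1/2} (X⁰_β - 2(1 + y²) ξ + y φ)(x, y)` -/
noncomputable def unitF (x y : ℝ) : E4 :=
  (√((1 + y ^ 2) * (5 + 4 * y ^ 2)))⁻¹ •
    (S.Xβ x y - (2 * (1 + y ^ 2)) • S.ξ x y + y • S.φ x y)

end CurvatureSurface

/-- The radius `(2√5)^{-1} √((5 + 4y²) / (1 + y²))` of the sphere `𝕊²_y`. -/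
noncomputable def radius (y : ℝ) : ℝ := (2 * √5)⁻¹ * √((5 + 4 * y ^ 2) / (1 + y ^ 2))

/-- The 2-sphere `𝕊²_y` of radius `radius y` with centre `A(y)` in the affine hyperplane through
`A(y)` perpendicular to `u(y)`. -/
def sphereY (u A : ℝ → E4) (y : ℝ) : Set E4 :=
  {p | inner ℝ (p - A y) (u y) = 0 ∧ ‖p - A y‖ = radius y}

/-- The objects `u(y)`, `v₁(y)`, `A(y)`, `b^∞`, `c^∞` belonging to a curvature surface.
Each of them is determined uniquely by these conditions:
`u` and `A` by the two formulas, `v₁` by its derivative equation and continuity, and `b^∞`, `c^∞`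
by the limit of `X⁰_α` as `x = e^{-s} → 0`. -/
structure AssociatedObjects (S : CurvatureSurface) (u v₁ A : ℝ → E4) (bInf cInf : E4) : Prop where
  u_eq : ∀ x y : ℝ, 0 < x → u y = (√(1 + y ^ 2))⁻¹ • (y • S.Xβ x y - S.φ x y)
  v₁_continuous : Continuous v₁
  u_deriv : ∀ y : ℝ, HasDerivAt u ((y ^ 2 / (1 + y ^ 2)) • v₁ y) y
  f_eq : ∀ x y : ℝ, 0 < x → S.f (x, y) = radius y • S.unitF x y + A y
  f_mem_sphere : ∀ x y : ℝ, 0 < x → S.f (x, y) ∈ sphereY u A y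
  orthonormal : ∀ y : ℝ, Orthonormal ℝ ![u y, v₁ y, bInf, cInf]
  tendsto_zero : TendstoUniformly
    (fun s y : ℝ => S.Xα (Real.exp (-s)) y -
      (Real.cos (√5 * s / 2) • bInf - Real.sin (√5 * s / 2) • cInf))
    (fun _ => (0 : E4)) atTop

/-- `w(x) = √5 ∫₀ˣ t / (2 X₀(t) - t X₀'(t)) dt` -/
noncomputable def w (x : ℝ) : ℝ := √5 * ∫ t in (0 : ℝ)..x, t / (2 * X0 t - t * dX0 t)

/-- `b̄(x) = cos w(x) b̂ - sin w(x) ĉ` -/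
noncomputable def bBar (bHat cHat : E4) (x : ℝ) : E4 :=
  Real.cos (w x) • bHat - Real.sin (w x) • cHat

/-- `c̄(x) = sin w(x) b̂ + cos w(x) ĉ` -/
noncomputable def cBar (bHat cHat : E4) (x : ℝ) : E4 :=
  Real.sin (w x) • bHat + Real.cos (w x) • cHat

/-- The limit circle
`-(2√5)^{-1} (1 + y²)^{-1/2} (v₁(y) + 2 (1 + y²)^{1/2} b̄(x)) + A(y)`. -/
noncomputable def limitCircle (v₁ A : ℝ → E4) (bHat cHat : E4) (x y : ℝ) : E4 :=
  -((2 * √5)⁻¹ * (√(1 + y ^ 2))⁻¹) • (v₁ y + (2 * √(1 + y ^ 2)) • bBar bHat cHat x) + A y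

/-- The curve `γ`, for `x ≥ 1`, winds around the point `p` of the unit sphere with tangent plane
spanned by the orthonormal vectors `e₁, e₂`: in the polar coordinates `(r, θ)` of the tangent
plane, `γ` never meets the axis (`r > 0`), and `θ` increases with speed between `m` and `M`. -/
def WindsAround (γ : ℝ → E4) (p e₁ e₂ : E4) (m M : ℝ) : Prop :=
  ∃ l r θ : ℝ → ℝ,
    (∀ x, 1 ≤ x → 0 < r x ∧
      γ x = l x • p + r x • (Real.cos (θ x) • e₁ + Real.sin (θ x) • e₂)) ∧
    (∀ x x', 1 ≤ x → x ≤ x' → m * (x' - x) ≤ θ x' - θ x ∧ θ x' - θ x ≤ M * (x' - x))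

end ConfFlat

/-! With `Y = X₀'/x`, `Z = xY'` and `G = 2X₀ - xX₀'`, the recurrence becomes a first-order system in
`X₀`, `Y`, `Z`, and the system has the first integral `Y G = 5 + (5/4) Y² + Z²` (`first_integral`).
It forces `Y, G > 0`. A Lyapunov function then gives that `xY` and `G/x` lie between positive
constants for large `x` and that `Z` is bounded (`exists_bounds`).

The geometry rests on an orthonormal frame `u, v, q, p` which separates the variables. The pair `u,
v` depends on `y` only. The pair `q, p` depends on `x` only and rotates in a fixed plane with speed
`K/x`. Here `q` is `X⁰_α` turned by an angle `ψ(x)` in the plane of `X⁰_α` and `ξ`, with `ψ` chosen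
to make `∂q/∂y` vanish. Undoing the rotation by `angle` turns `q, p` into the constant vectors `b^∞,
c^∞`. The original frame is recovered from `n = (κ - 1) v + axisDist p`, where `axisDist² + (κ - 1)²
= 1`, and from `X⁰_α, ξ` as rotations of `q` and `m = axisDist v - (κ - 1) p`.

All limits for `x → ∞` follow from `κ → 0`, uniform on compact sets of `y`: then `n → -v`, `m - p →
0`, and `X⁰_α, ξ` approach a pair rotating in the fixed plane with phase `angle - ψ`. That this
phase is `w` up to a constant `δ` is the analytic core (`exists_tendsto_angle_sub_psi_sub_w`): the
difference of the derivatives is only of order `1/x`, but after subtracting the correction `Z/G`,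
which tends to zero, the order `1/x` terms cancel by the first integral. Infinite length holds
because `axisDist ≥ c/x` while the angle grows at least linearly, so the half turns contribute a
harmonic series. -/

namespace ConfFlat

/-! ### Entire power series -/

/-- The sum of the power series with coefficients `a`. -/
noncomputable def entireSum (a : ℕ → ℝ) (t : ℝ) : ℝ := ∑' k : ℕ, a k * t ^ k

/-- The coefficients of the derivative of a power series. -/
def derivCoeff (a : ℕ → ℝ) (k : ℕ) : ℝ := ((k : ℝ) + 1) * a (k + 1)

/-- The coefficients are bounded by a multiple of `1 / k!`. -/
def FactorialBound (a : ℕ → ℝ) : Prop := ∃ C : ℝ, ∀ k, |a k| ≤ C / (k.factorial : ℝ)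

/-- The factor `k + 1` cancels against `(k + 1)!`, so the same constant serves for all derivatives.
-/
theorem FactorialBound.derivCoeff {a : ℕ → ℝ} (ha : FactorialBound a) :
    FactorialBound (derivCoeff a) := by
  obtain ⟨C, hC⟩ := ha
  refine ⟨C, fun k => ?_⟩
  have h1 := hC (k + 1)
  have hk : (0 : ℝ) < (k : ℝ) + 1 := by positivity
  have hf : (0 : ℝ) < (k.factorial : ℝ) := by positivity
  rw [Nat.factorial_succ] at h1
  push_cast at h1
  rw [ConfFlat.derivCoeff, abs_mul, abs_of_pos hk]
  calc ((k : ℝ) + 1) * |a (k + 1)| ≤ (k + 1) * (C / ((k + 1) * k.factorial)) := by gcongr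
    _ = C / k.factorial := by field_simp

theorem FactorialBound.summable {a : ℕ → ℝ} (ha : FactorialBound a) (t : ℝ) :
    Summable fun k => a k * t ^ k := by
  obtain ⟨C, hC⟩ := ha
  refine Summable.of_norm_bounded ((Real.summable_pow_div_factorial |t|).mul_left C) fun k => ?_
  rw [norm_mul, norm_pow, Real.norm_eq_abs, Real.norm_eq_abs]
  calc |a k| * |t| ^ k ≤ C / k.factorial * |t| ^ k := by gcongr; exact hC k
    _ = _ := by ring

theorem hasDerivAt_entireSum {a : ℕ → ℝ} (ha : FactorialBound a) (t : ℝ) :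
    HasDerivAt (entireSum a) (entireSum (derivCoeff a) t) t := by
  have hb := ha.derivCoeff
  obtain ⟨C, hC⟩ := hb
  have hR : (0 : ℝ) ≤ |t| + 1 := by positivity
  set R := |t| + 1 with hRdef
  have key : HasDerivAt (fun z => ∑' k, a k * z ^ k) (∑' k, a k * (k * t ^ (k - 1))) t := by
    refine hasDerivAt_tsum_of_isPreconnected (u := fun k => |a k| * (k * R ^ (k - 1)))
      (t := Metric.ball 0 R) ?_ Metric.isOpen_ball (convex_ball _ _).isPreconnected
      (fun n y _ => (hasDerivAt_pow n y).const_mul (a n)) ?_ (y₀ := t) ?_ (ha.summable t) ?_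
    · rw [← summable_nat_add_iff 1]
      refine Summable.of_nonneg_of_le (fun k => by positivity) (fun k => ?_)
        ((Real.summable_pow_div_factorial R).mul_left C)
      have h1 := hC k
      rw [derivCoeff, abs_mul, abs_of_pos (by positivity)] at h1
      push_cast
      calc |a (k + 1)| * ((k + 1) * R ^ (k + 1 - 1)) = ((k + 1) * |a (k + 1)|) * R ^ k := by
            simp; ring
        _ ≤ C / k.factorial * R ^ k := by gcongr
        _ = _ := by ring
    · intro n y hy
      rw [norm_mul, norm_mul, norm_pow, Real.norm_eq_abs, Real.norm_natCast]
      have : ‖y‖ ≤ R := by simpa using (mem_ball_zero_iff.1 hy).le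
      gcongr
    · simp [hRdef]
    · simp [hRdef]
  have hs : (∑' k, a k * (k * t ^ (k - 1))) = entireSum (derivCoeff a) t := by
    rw [tsum_eq_zero_add']
    · simp only [entireSum, derivCoeff]
      simp
      congr 1; ext k; ring
    · refine (ha.derivCoeff.summable t).congr fun k => ?_
      simp [derivCoeff]; ring
  rw [← hs]
  exact key

theorem hasSum_mul_entireSum_derivCoeff {a : ℕ → ℝ} (ha : FactorialBound a) (t : ℝ) :
    HasSum (fun k : ℕ => k * a k * t ^ k) (t * entireSum (derivCoeff a) t) := by
  rw [← hasSum_nat_add_iff' 1]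
  have h := ((ha.derivCoeff.summable t).hasSum).mul_left t
  rw [Finset.range_one, Finset.sum_singleton, Nat.cast_zero, zero_mul, zero_mul, sub_zero]
  have e : ∀ k : ℕ, t * (derivCoeff a k * t ^ k) = ((k + 1 : ℕ) : ℝ) * a (k + 1) * t ^ (k + 1) :=
    fun k => by rw [derivCoeff]; push_cast; ring
  exact (funext e) ▸ h

/-! ### The function `X₀` and its companions -/

theorem factorialBound_coeffX : FactorialBound coeffX := by
  have h1 : ∀ k : ℕ, |coeffX (k + 1)| ≤ 1 / ((k + 1).factorial : ℝ) := by
    intro k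
    induction k with
    | zero => simp [coeffX]
    | succ k ih =>
      rw [show k + 1 + 1 = k + 2 from rfl, coeffX, abs_mul, abs_neg, Nat.factorial_succ (k + 1)]
      -- The ratio of consecutive coefficients is at most `1/(k + 2)`, which is the step from `(k +
      -- 1)!` to `(k + 2)!`.
      have h2 : |(2 * ((k : ℝ) + 1) - 1) / (2 * ((k : ℝ) + 2) * (4 * ((k : ℝ) + 1) ^ 2 + 5 / 4))|
          ≤ 1 / ((k : ℝ) + 2) := by
        rw [abs_of_nonneg (div_nonneg (by linarith [(Nat.cast_nonneg k : (0 : ℝ) ≤ k)])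
          (by positivity)), div_le_div_iff₀ (by positivity) (by positivity)]
        have hk : (0 : ℝ) ≤ k := Nat.cast_nonneg k
        nlinarith [mul_nonneg hk hk, mul_nonneg hk (mul_nonneg hk hk)]
      calc _ ≤ 1 / ((k : ℝ) + 2) * (1 / ((k + 1).factorial : ℝ)) := by gcongr
        _ = _ := by push_cast; field_simp; ring
  refine ⟨5 / 2, fun k => ?_⟩
  cases k with
  | zero => simp [coeffX, abs_of_pos]
  | succ k => exact (h1 k).trans (by gcongr; norm_num)

/-- `X₀'(x) / x` -/
noncomputable def Y (x : ℝ) : ℝ := 2 * entireSum (derivCoeff coeffX) (x ^ 2)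

/-- `x (X₀' / x)'` -/
noncomputable def Z (x : ℝ) : ℝ :=
  4 * x ^ 2 * entireSum (derivCoeff (derivCoeff coeffX)) (x ^ 2)

/-- `2 X₀ - x X₀'` -/
noncomputable def G (x : ℝ) : ℝ := 2 * X0 x - x ^ 2 * Y x

theorem X0_eq (x : ℝ) : X0 x = entireSum coeffX (x ^ 2) := by
  simp only [X0, entireSum, pow_mul]

theorem hasDerivAt_X0 (x : ℝ) : HasDerivAt X0 (x * Y x) x := by
  have h := (hasDerivAt_entireSum factorialBound_coeffX (x ^ 2)).comp x (hasDerivAt_pow 2 x)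
  rw [show X0 = entireSum coeffX ∘ fun x => x ^ 2 from funext X0_eq]
  exact h.congr_deriv (by rw [Y]; norm_num; ring)

theorem dX0_eq (x : ℝ) : dX0 x = x * Y x := (hasDerivAt_X0 x).deriv

/-- Coefficient form of the differential equation in `t = x²`. The case `k = 0` lies outside the
defining recurrence and accounts for the constant term `5/2`. -/
theorem coeffX_recurrence (k : ℕ) :
    8 * (k * (k - 1) * derivCoeff coeffX k) + 8 * (k * derivCoeff coeffX k)
      + 5 / 2 * derivCoeff coeffX k + 2 * (k * coeffX k) - coeffX k = 0 := by
  cases k with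
  | zero => simp [derivCoeff, coeffX]
  | succ k =>
    simp only [derivCoeff, coeffX]
    push_cast
    field_simp
    ring

theorem series_ode (t : ℝ) :
    8 * (t ^ 2 * entireSum (derivCoeff (derivCoeff (derivCoeff coeffX))) t)
      + 8 * (t * entireSum (derivCoeff (derivCoeff coeffX)) t)
      + 5 / 2 * entireSum (derivCoeff coeffX) t + 2 * (t * entireSum (derivCoeff coeffX) t)
      - entireSum coeffX t = 0 := by
  have ha := factorialBound_coeffX
  have h0 := (ha.summable t).hasSum
  have h1 := (ha.derivCoeff.summable t).hasSum
  have h2 := hasSum_mul_entireSum_derivCoeff ha t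
  have h3 := hasSum_mul_entireSum_derivCoeff ha.derivCoeff t
  have h4 : HasSum (fun k : ℕ => k * (k - 1) * derivCoeff coeffX k * t ^ k)
      (t ^ 2 * entireSum (derivCoeff (derivCoeff (derivCoeff coeffX))) t) := by
    rw [← hasSum_nat_add_iff' 1]
    have h := (hasSum_mul_entireSum_derivCoeff ha.derivCoeff.derivCoeff t).mul_left t
    rw [Finset.range_one, Finset.sum_singleton, Nat.cast_zero, zero_mul, zero_mul, zero_mul,
      sub_zero, pow_two, mul_assoc]
    have e : ∀ k : ℕ, t * (k * derivCoeff (derivCoeff coeffX) k * t ^ k) =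
        ((k + 1 : ℕ) : ℝ) * (((k + 1 : ℕ) : ℝ) - 1) * derivCoeff coeffX (k + 1) * t ^ (k + 1) :=
      fun k => by rw [show derivCoeff (derivCoeff coeffX) k = (k + 1) * derivCoeff coeffX (k + 1)
        from rfl]; push_cast; ring
    exact (funext e) ▸ h
  have h5 := ((((h4.mul_left 8).add (h3.mul_left 8)).add (h1.mul_left (5 / 2))).add
    (h2.mul_left 2)).sub h0
  refine h5.unique ?_
  convert hasSum_zero using 1
  ext k
  linear_combination t ^ k * coeffX_recurrence k

theorem hasDerivAt_Y (x : ℝ) : HasDerivAt Y (Z x / x) x := by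
  have h := ((hasDerivAt_entireSum factorialBound_coeffX.derivCoeff (x ^ 2)).comp x
    (hasDerivAt_pow 2 x)).const_mul 2
  refine h.congr_deriv ?_
  rcases eq_or_ne x 0 with rfl | hx
  · simp [Z]
  · rw [Z]; field_simp; norm_num; ring

/-- Closes the system `X₀' = xY`, `xY' = Z`, `xZ' = X₀ - x²Y - (5/4)Y`. At `x = 0` the quotient is
`0` by the convention for division, which is also the true derivative of an even function. -/
theorem hasDerivAt_Z (x : ℝ) :
    HasDerivAt Z ((X0 x - x ^ 2 * Y x - 5 / 4 * Y x) / x) x := by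
  have h := ((hasDerivAt_entireSum factorialBound_coeffX.derivCoeff.derivCoeff (x ^ 2)).comp x
    (hasDerivAt_pow 2 x))
  refine (((hasDerivAt_pow 2 x).const_mul 4).mul h).congr_deriv ?_
  rcases eq_or_ne x 0 with rfl | hx
  · simp
  · rw [eq_div_iff hx, X0_eq, Y]
    simp only [Function.comp]
    norm_num
    linear_combination (series_ode (x ^ 2))

theorem hasDerivAt_G (x : ℝ) : HasDerivAt G (-(x * Z x)) x := by
  have h := ((hasDerivAt_X0 x).const_mul 2).sub ((hasDerivAt_pow 2 x).mul (hasDerivAt_Y x))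
  refine h.congr_deriv ?_
  rcases eq_or_ne x 0 with rfl | hx
  · simp
  · field_simp; norm_num; ring

theorem differentiable_Z : Differentiable ℝ Z := fun x => (hasDerivAt_Z x).differentiableAt

theorem differentiable_X0 : Differentiable ℝ X0 := fun x => (hasDerivAt_X0 x).differentiableAt

theorem differentiable_Y : Differentiable ℝ Y := fun x => (hasDerivAt_Y x).differentiableAt

theorem differentiable_G : Differentiable ℝ G :=
  (differentiable_X0.const_mul 2).sub ((differentiable_pow 2).mul differentiable_Y)

theorem entireSum_zero (a : ℕ → ℝ) : entireSum a 0 = a 0 := by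
  rw [entireSum, tsum_eq_single 0 (fun k hk => by simp [hk])]; simp

theorem X0_zero : X0 0 = 5 / 2 := by simp [X0_eq, entireSum_zero, coeffX]

theorem Y_zero : Y 0 = 2 := by simp [Y, entireSum_zero, coeffX, derivCoeff]

theorem Z_zero : Z 0 = 0 := by simp [Z]

theorem G_zero : G 0 = 5 := by rw [G, X0_zero]; norm_num

/-- The difference of the two sides is conserved by the system, and at `x = 0` both are `10`. -/
theorem first_integral (x : ℝ) : Y x * G x = 5 + 5 / 4 * Y x ^ 2 + Z x ^ 2 := by
  have hd : ∀ z, HasDerivAt (fun z => Y z * G z - 5 / 4 * Y z ^ 2 - Z z ^ 2) 0 z := fun z => by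
    refine ((((hasDerivAt_Y z).mul (hasDerivAt_G z)).sub
      (((hasDerivAt_Y z).pow 2).const_mul (5 / 4))).sub ((hasDerivAt_Z z).pow 2)).congr_deriv ?_
    rcases eq_or_ne z 0 with rfl | hz
    · simp
    · rw [G]; field_simp; norm_num; ring
  have h := is_const_of_deriv_eq_zero (fun z => (hd z).differentiableAt) (fun z => (hd z).deriv) x 0
  simp only [Y_zero, G_zero, Z_zero] at h
  linarith

/-- At a zero of `Y` the first integral would read `0 = 5 + Z²`; since `Y 0 = 2`, continuity
excludes a change of sign. -/
theorem Y_pos (x : ℝ) : 0 < Y x := by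
  have hne : ∀ z, Y z ≠ 0 := fun z hz => by
    have := first_integral z
    rw [hz] at this
    nlinarith [sq_nonneg (Z z)]
  by_contra hx
  have := mem_range_of_exists_le_of_exists_ge differentiable_Y.continuous
    ⟨x, not_lt.1 hx⟩ ⟨0, by rw [Y_zero]; norm_num⟩
  obtain ⟨z, hz⟩ := this
  exact hne z hz

theorem G_gt (x : ℝ) : 5 / 4 * Y x < G x := by
  have := first_integral x
  have hY := Y_pos x
  by_contra hx
  nlinarith [mul_le_mul_of_nonneg_left (not_lt.1 hx) hY.le, sq_nonneg (Z x)]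

theorem G_pos (x : ℝ) : 0 < G x := by linarith [G_gt x, Y_pos x]

theorem X0_pos (x : ℝ) : 0 < X0 x := by
  have h : G x = 2 * X0 x - x ^ 2 * Y x := rfl
  nlinarith [G_pos x, mul_nonneg (sq_nonneg x) (Y_pos x).le]

/-! ### Bounds for large `x` -/

/-- Arithmetic-geometric mean inequality: the product of the two summands is `Y G ≥ Z²`. -/
theorem two_mul_abs_Z_le {x : ℝ} (hx : 0 < x) : 2 * |Z x| ≤ x * Y x + G x / x := by
  have hp : 0 < x * Y x := mul_pos hx (Y_pos x)
  have hg : 0 < G x / x := div_pos (G_pos x) hx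
  have hpg : x * Y x * (G x / x) = Y x * G x := by field_simp
  refine abs_le_of_sq_le_sq' (a := 2 * |Z x|) ?_ (by positivity) |>.2
  rw [mul_pow, sq_abs]
  nlinarith [first_integral x, sq_nonneg (x * Y x - G x / x), sq_nonneg (Y x)]

theorem exists_upper_bound_two :
    ∃ C : ℝ, ∀ x, 2 ≤ x → x * Y x + G x / x ≤ C := by
  -- The derivative of `xY + G/x` is `Y - G/x²`. Adding `2Z/x` cancels it up to terms of order `x⁻²`
  -- in `Y` and `Z`, and the factor `exp (2/x)` absorbs what remains, making `N` decreasing on `[2,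
  -- ∞)`.
  let N : ℝ → ℝ := fun x => (x * Y x + G x / x + 2 * (Z x / x)) * Real.exp (2 / x)
  have hd : ∀ x, 0 < x → HasDerivAt N
      ((-(5 / 2 * Y x + 2 * Z x) / x ^ 2 - 2 / x ^ 2 * (x * Y x + G x / x + 2 * (Z x / x)))
        * Real.exp (2 / x)) x := fun x hx => by
    have h1 := (((hasDerivAt_id x).mul (hasDerivAt_Y x)).add
      ((hasDerivAt_G x).div (hasDerivAt_id x) hx.ne')).add
        (((hasDerivAt_Z x).div (hasDerivAt_id x) hx.ne').const_mul 2)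
    have h2 := (((hasDerivAt_const x (2 : ℝ)).div (hasDerivAt_id x) hx.ne')).exp
    refine (h1.mul h2).congr_deriv ?_
    simp only [id, Pi.add_apply, Pi.mul_apply, Pi.div_apply]
    rw [show X0 x = (G x + x ^ 2 * Y x) / 2 by rw [G]; ring]
    field_simp
    ring
  have hlow : ∀ x, 2 ≤ x → (x * Y x + G x / x) / 2 ≤ x * Y x + G x / x + 2 * (Z x / x) := by
    intro x hx
    have h1 := two_mul_abs_Z_le (show 0 < x by linarith)
    have h2 : -(2 * (Z x / x)) ≤ |Z x| := by
      rw [show -(2 * (Z x / x)) = (2 / x) * (-Z x) by ring]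
      have : 2 / x ≤ 1 := (div_le_one (by linarith)).2 hx
      calc 2 / x * (-Z x) ≤ 2 / x * |Z x| :=
            mul_le_mul_of_nonneg_left (neg_le_abs _) (by positivity)
        _ ≤ 1 * |Z x| := by gcongr
        _ = _ := one_mul _
    linarith
  have hanti : AntitoneOn N (Set.Ici 2) := by
    refine antitoneOn_of_deriv_nonpos (convex_Ici 2) (fun x hx => ?_) (fun x hx => ?_)
      (fun x hx => ?_)
    · exact (hd x (by linarith [Set.mem_Ici.1 hx])).continuousAt.continuousWithinAt
    · rw [interior_Ici] at hx
      exact (hd x (by linarith [Set.mem_Ioi.1 hx])).differentiableAt.differentiableWithinAt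
    · rw [interior_Ici, Set.mem_Ioi] at hx
      rw [(hd x (by linarith)).deriv]
      refine mul_nonpos_of_nonpos_of_nonneg ?_ (Real.exp_pos _).le
      have h1 := two_mul_abs_Z_le (show 0 < x by linarith)
      have h2 := hlow x hx.le
      rw [show -(5 / 2 * Y x + 2 * Z x) / x ^ 2 - 2 / x ^ 2 * (x * Y x + G x / x + 2 * (Z x / x))
        = (-(5 / 2 * Y x + 2 * Z x) - 2 * (x * Y x + G x / x + 2 * (Z x / x))) / x ^ 2 by ring]
      refine div_nonpos_of_nonpos_of_nonneg ?_ (sq_nonneg x)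
      linarith [neg_le_abs (Z x), Y_pos x]
  refine ⟨2 * N 2, fun x hx => ?_⟩
  have h1 : N x ≤ N 2 := hanti (Set.mem_Ici.2 le_rfl) hx hx
  have h2 := hlow x hx
  have hpos : 0 ≤ x * Y x + G x / x + 2 * (Z x / x) :=
    le_trans (by have := Y_pos x; have := G_pos x; positivity) h2
  have h3 : x * Y x + G x / x + 2 * (Z x / x) ≤ N x :=
    le_mul_of_one_le_right hpos (Real.one_le_exp (by positivity))
  linarith

theorem exists_bounds : ∃ m M : ℝ, 0 < m ∧ 0 < M ∧ ∀ x, 1 ≤ x →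
    m ≤ x * Y x ∧ x * Y x ≤ M ∧ m * x ≤ G x ∧ G x ≤ M * x ∧ |Z x| ≤ M := by
  obtain ⟨C₁, hC₁⟩ := exists_upper_bound_two
  have hcont : ContinuousOn (fun x => x * Y x + G x / x) (Set.Icc 1 2) := by
    refine (continuous_id.mul differentiable_Y.continuous).continuousOn.add
      (differentiable_G.continuous.continuousOn.div continuousOn_id fun x hx => ?_)
    exact (zero_lt_one.trans_le hx.1).ne'
  obtain ⟨C₂, hC₂⟩ := isCompact_Icc.bddAbove_image hcont
  set C := max C₁ C₂
  have hC : ∀ x, 1 ≤ x → x * Y x + G x / x ≤ C := fun x hx => by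
    rcases le_total x 2 with h | h
    · exact (hC₂ (Set.mem_image_of_mem _ ⟨hx, h⟩)).trans (le_max_right _ _)
    · exact (hC₁ x h).trans (le_max_left _ _)
  have hCpos : 0 < C := lt_of_lt_of_le (by have := Y_pos 1; have := G_pos 1; positivity)
    (hC 1 le_rfl)
  refine ⟨5 / C, C, by positivity, hCpos, fun x hx => ?_⟩
  have hx0 : 0 < x := by linarith
  have hp : 0 < x * Y x := mul_pos hx0 (Y_pos x)
  have hg : 0 < G x / x := div_pos (G_pos x) hx0
  -- A product bounded below with a sum bounded above bounds each factor from below.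
  have hpg : 5 ≤ x * Y x * (G x / x) := by
    rw [show x * Y x * (G x / x) = Y x * G x by field_simp]
    nlinarith [first_integral x, sq_nonneg (Y x), sq_nonneg (Z x)]
  have h := hC x hx
  refine ⟨?_, by linarith, ?_, ?_, ?_⟩
  · rw [div_le_iff₀ hCpos]; nlinarith
  · rw [← le_div_iff₀ hx0, div_le_iff₀ hCpos]; nlinarith
  · rw [← div_le_iff₀ hx0]; linarith
  · linarith [two_mul_abs_Z_le hx0, abs_nonneg (Z x)]

/-! ### The winding rate -/

theorem sq_sqrt_five : (√5 : ℝ) ^ 2 = 5 := Real.sq_sqrt (by norm_num)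

/-- `G + √5 - Y` -/
noncomputable def H (x : ℝ) : ℝ := G x + √5 - Y x

theorem H_gt (x : ℝ) : G x / 5 < H x := by
  have := G_gt x
  have : 0 < √5 := by positivity
  rw [H]; linarith

theorem H_pos (x : ℝ) : 0 < H x := by linarith [H_gt x, G_pos x]

theorem differentiable_H : Differentiable ℝ H :=
  (differentiable_G.add_const _).sub differentiable_Y

theorem H_zero : H 0 = 3 + √5 := by rw [H, G_zero, Y_zero]; ring

/-- `x` times the rate of rotation of the adapted frame. -/
noncomputable def K (x : ℝ) : ℝ := (2 * X0 x + √5) * (Y x + 2 * √5) / (4 * (Y x * H x))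

theorem K_pos (x : ℝ) : 0 < K x := by
  have := X0_pos x; have := Y_pos x; have := H_pos x
  unfold K; positivity

theorem differentiable_K : Differentiable ℝ K := fun x => by
  have := differentiable_X0 x; have := differentiable_Y x; have := differentiable_H x
  have h1 := (mul_pos (Y_pos x) (H_pos x)).ne'
  unfold K
  fun_prop (disch := simpa using h1)

/-- This value is the coefficient of `log x` in `angle`, hence the frequency in the limit `x =
e^{-s} → 0`. -/
theorem K_zero : K 0 = √5 / 2 := by
  have : 0 < 3 + √5 := by positivity
  rw [K, X0_zero, Y_zero, H_zero, div_eq_iff (by positivity)]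
  linear_combination (-2 : ℝ) * sq_sqrt_five

theorem continuous_dslope_K : Continuous (dslope K 0) := by
  refine continuous_iff_continuousAt.2 fun x => ?_
  rcases eq_or_ne x 0 with rfl | hx
  · exact continuousAt_dslope_same.2 (differentiable_K 0)
  · exact (continuousAt_dslope_of_ne hx).2 (differentiable_K x).continuousAt

/-- The angle of rotation of the adapted frame. -/
noncomputable def angle (x : ℝ) : ℝ := √5 / 2 * Real.log x + ∫ t in (0 : ℝ)..x, dslope K 0 t

theorem hasDerivAt_angle {x : ℝ} (hx : 0 < x) : HasDerivAt angle (K x / x) x := by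
  have h := ((Real.hasDerivAt_log hx.ne').const_mul (√5 / 2)).add
    (intervalIntegral.integral_hasDerivAt_right (continuous_dslope_K.intervalIntegrable 0 x)
      (continuous_dslope_K.stronglyMeasurableAtFilter _ _) continuous_dslope_K.continuousAt)
  refine h.congr_deriv ?_
  rw [dslope_of_ne _ hx.ne', slope_def_field, K_zero, sub_zero]
  field_simp
  ring

/-- The logarithm contributes `-√5 s/2` exactly, and the remaining integral vanishes at `0`. -/
theorem tendsto_angle_zero :
    Tendsto (fun s : ℝ => angle (Real.exp (-s)) + √5 * s / 2) atTop (𝓝 0) := by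
  have h1 : Continuous fun x : ℝ => ∫ t in (0 : ℝ)..x, dslope K 0 t :=
    intervalIntegral.continuous_primitive
      (fun a b => continuous_dslope_K.intervalIntegrable a b) 0
  have h2 := (h1.tendsto 0).comp (Real.tendsto_exp_neg_atTop_nhds_zero)
  rw [intervalIntegral.integral_same] at h2
  refine h2.congr fun s => ?_
  simp only [Function.comp, angle, Real.log_exp]
  ring

theorem exists_bounds_angle :
    ∃ m M : ℝ, 0 < m ∧ ∀ x, 1 ≤ x → m ≤ K x / x ∧ K x / x ≤ M := by
  obtain ⟨m, M, hm, hM, h⟩ := exists_bounds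
  have hs : 0 < √5 := by positivity
  refine ⟨m * (2 * √5) / (4 * (M * (M + √5))),
    (2 * M + √5) * (M + 2 * √5) / (4 * (m * (m / 5))), by positivity, fun x hx => ?_⟩
  have hx0 : 0 < x := by linarith
  obtain ⟨h1, h2, h3, h4, -⟩ := h x hx
  have hY := Y_pos x
  have hG := G_pos x
  have hH := H_pos x
  have hX := X0_pos x
  -- Distributing the powers of `x` makes every factor bounded above and below.
  have e : K x / x = ((2 * X0 x + √5) / x) * (Y x + 2 * √5) / (4 * ((x * Y x) * (H x / x))) := by
    rw [K]; field_simp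
  have hYle : Y x ≤ M := by nlinarith
  have hXe : 2 * X0 x = G x + x * (x * Y x) := by rw [G]; ring
  have a1 : m ≤ (2 * X0 x + √5) / x := by
    rw [le_div_iff₀ hx0, hXe]; nlinarith [mul_pos hx0 (mul_pos hx0 hY)]
  have a2 : (2 * X0 x + √5) / x ≤ 2 * M + √5 := by
    rw [div_le_iff₀ hx0, hXe]; nlinarith
  have a3 : m / 5 ≤ H x / x := by
    rw [le_div_iff₀ hx0]; linarith [H_gt x]
  have a4 : H x / x ≤ M + √5 := by
    rw [div_le_iff₀ hx0, H]; nlinarith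
  rw [e]
  constructor
  · gcongr; linarith
  · gcongr

/-! ### The angle between `X⁰_α` and the adapted frame -/

/-- `√((Y + 2√5)² + 4 Z²)` -/
noncomputable def rho (x : ℝ) : ℝ := √(4 * (Y x * H x))

theorem rho_pos (x : ℝ) : 0 < rho x :=
  Real.sqrt_pos.2 (by have := Y_pos x; have := H_pos x; positivity)

theorem rho_sq (x : ℝ) : rho x ^ 2 = 4 * (Y x * H x) :=
  Real.sq_sqrt (by have := Y_pos x; have := H_pos x; positivity)

/-- The first integral as a sum of two squares: this is what makes `cosPsi` and `sinPsi` a cosine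
and a sine. -/
theorem four_mul_Y_mul_H (x : ℝ) : 4 * (Y x * H x) = (Y x + 2 * √5) ^ 2 + (2 * Z x) ^ 2 := by
  rw [H]; linear_combination 4 * first_integral x - 4 * sq_sqrt_five

theorem differentiable_rho : Differentiable ℝ rho := fun x => by
  have h := mul_pos (Y_pos x) (H_pos x)
  exact (((differentiable_Y x).mul (differentiable_H x)).const_mul 4).sqrt
    (by simpa using ⟨(Y_pos x).ne', (H_pos x).ne'⟩)

/-- `cos ψ` -/
noncomputable def cosPsi (x : ℝ) : ℝ := (Y x + 2 * √5) / rho x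

/-- `sin ψ` -/
noncomputable def sinPsi (x : ℝ) : ℝ := 2 * Z x / rho x

theorem cosPsi_sq_add_sinPsi_sq (x : ℝ) : cosPsi x ^ 2 + sinPsi x ^ 2 = 1 := by
  rw [cosPsi, sinPsi, div_pow, div_pow, ← add_div, rho_sq, four_mul_Y_mul_H, div_self]
  rw [← four_mul_Y_mul_H, ← rho_sq]
  exact (pow_pos (rho_pos x) 2).ne'

theorem differentiable_cosPsi : Differentiable ℝ cosPsi := fun x =>
  ((differentiable_Y x).add_const _).div (differentiable_rho x) (rho_pos x).ne'

theorem differentiable_sinPsi : Differentiable ℝ sinPsi := fun x =>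
  ((differentiable_Z x).const_mul _).div (differentiable_rho x) (rho_pos x).ne'

theorem cosPsi_pos (x : ℝ) : 0 < cosPsi x := by
  have := Y_pos x; have := rho_pos x
  unfold cosPsi; positivity

theorem cosPsi_zero : cosPsi 0 = 1 := by
  have h := cosPsi_sq_add_sinPsi_sq 0
  rw [sinPsi, Z_zero, mul_zero, zero_div] at h
  nlinarith [cosPsi_pos 0]

/-- The angle with cosine `cosPsi` and sine `sinPsi`. -/
noncomputable def psi (x : ℝ) : ℝ := Real.arctan (2 * Z x / (Y x + 2 * √5))

theorem Y_add_pos (x : ℝ) : 0 < Y x + 2 * √5 := by have := Y_pos x; positivity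

theorem sqrt_one_add_psi (x : ℝ) :
    √(1 + (2 * Z x / (Y x + 2 * √5)) ^ 2) = rho x / (Y x + 2 * √5) := by
  have h := Y_add_pos x
  rw [rho, four_mul_Y_mul_H, ← Real.sqrt_sq h.le, ← Real.sqrt_div (by positivity),
    Real.sqrt_sq h.le]
  congr 1
  field_simp

theorem cos_psi (x : ℝ) : Real.cos (psi x) = cosPsi x := by
  rw [psi, Real.cos_arctan, sqrt_one_add_psi, cosPsi, one_div_div]

theorem sin_psi (x : ℝ) : Real.sin (psi x) = sinPsi x := by
  have := Y_add_pos x; have := rho_pos x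
  rw [psi, Real.sin_arctan, sqrt_one_add_psi, sinPsi]
  field_simp

/-- The limiting phase of `X⁰_α` and `ξ`. The factor `Y` of the denominators of both `K` and `ψ'`
drops out by the first integral. -/
theorem hasDerivAt_angle_sub_psi {x : ℝ} (hx : 0 < x) :
    HasDerivAt (fun x => angle x - psi x)
      ((3 * √5 + x ^ 2 * Y x + 2 * √5 * x ^ 2 + G x) / (2 * x * H x)) x := by
  have hY := Y_pos x
  have hH := H_pos x
  have hY5 := Y_add_pos x
  have h1 := ((((hasDerivAt_Z x).const_mul 2).div ((hasDerivAt_Y x).add_const (2 * √5))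
    hY5.ne')).arctan
  refine ((hasDerivAt_angle hx).sub h1).congr_deriv ?_
  have e : 1 + (2 * Z x / (Y x + 2 * √5)) ^ 2 = 4 * (Y x * H x) / (Y x + 2 * √5) ^ 2 := by
    rw [four_mul_Y_mul_H]; field_simp
  simp only [Pi.div_apply]
  rw [e, K]
  field_simp
  linear_combination -16 * first_integral x + 16 * sq_sqrt_five

/-! ### Behaviour at infinity -/

theorem hasDerivAt_w (x : ℝ) : HasDerivAt w (√5 * (x / G x)) x := by
  have e : (fun t => t / (2 * X0 t - t * dX0 t)) = fun t => t / G t := by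
    ext t; rw [dX0_eq, G]; ring_nf
  have hc : Continuous fun t => t / G t :=
    continuous_id.div differentiable_G.continuous fun t => (G_pos t).ne'
  have h := (intervalIntegral.integral_hasDerivAt_right (hc.intervalIntegrable 0 x)
    (hc.stronglyMeasurableAtFilter _ _) hc.continuousAt).const_mul √5
  unfold w
  rw [e]
  exact h

theorem isBigO_of_abs_le {f g : ℝ → ℝ} (C : ℝ) (h : ∀ x, 1 ≤ x → |f x| ≤ C * |g x|) :
    f =O[atTop] g :=
  Asymptotics.IsBigO.of_bound C ((eventually_ge_atTop 1).mono fun x hx => h x hx)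

theorem isBigO_Y : Y =O[atTop] fun x => x⁻¹ := by
  obtain ⟨m, M, hm, hM, h⟩ := exists_bounds
  refine isBigO_of_abs_le M fun x hx => ?_
  have hx0 : 0 < x := by linarith
  rw [abs_of_pos (Y_pos x), abs_of_pos (inv_pos.2 hx0), ← div_eq_mul_inv, le_div_iff₀ hx0, mul_comm]
  exact (h x hx).2.1

theorem isBigO_inv_G : (fun x => (G x)⁻¹) =O[atTop] fun x => x⁻¹ := by
  obtain ⟨m, M, hm, hM, h⟩ := exists_bounds
  refine isBigO_of_abs_le m⁻¹ fun x hx => ?_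
  have hx0 : 0 < x := by linarith
  rw [abs_of_pos (inv_pos.2 (G_pos x)), abs_of_pos (inv_pos.2 hx0), ← mul_inv]
  exact inv_anti₀ (by positivity) (h x hx).2.2.1

theorem isBigO_inv_H : (fun x => (H x)⁻¹) =O[atTop] fun x => x⁻¹ := by
  refine Asymptotics.IsBigO.trans (isBigO_of_abs_le 5 fun x _ => ?_) isBigO_inv_G
  have hG := G_pos x
  rw [abs_of_pos (inv_pos.2 (H_pos x)), abs_of_pos (inv_pos.2 hG), ← div_eq_mul_inv]
  rw [show 5 / G x = (G x / 5)⁻¹ by rw [inv_div]]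
  exact inv_anti₀ (by positivity) (H_gt x).le

theorem isBigO_X0 : X0 =O[atTop] fun x => x := by
  obtain ⟨m, M, hm, hM, h⟩ := exists_bounds
  refine isBigO_of_abs_le M fun x hx => ?_
  have hx0 : 0 < x := by linarith
  obtain ⟨-, h2, -, h4, -⟩ := h x hx
  rw [abs_of_pos (X0_pos x), abs_of_pos hx0]
  have hXe : 2 * X0 x = G x + x * (x * Y x) := by rw [G]; ring
  nlinarith

theorem isBigO_Z : Z =O[atTop] fun _ => (1 : ℝ) := by
  obtain ⟨m, M, hm, hM, h⟩ := exists_bounds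
  exact isBigO_of_abs_le M fun x hx => by simpa using (h x hx).2.2.2.2

theorem tendsto_Z_div_G : Tendsto (fun x => Z x / G x) atTop (𝓝 0) := by
  refine ((isBigO_Z.mul isBigO_inv_G).trans_tendsto ?_).congr fun x => (div_eq_mul_inv _ _).symm
  simpa using tendsto_inv_atTop_zero (𝕜 := ℝ)

theorem tendsto_Y_div_G : Tendsto (fun x => Y x / G x) atTop (𝓝 0) := by
  refine ((isBigO_Y.mul isBigO_inv_G).trans_tendsto ?_).congr fun x => (div_eq_mul_inv _ _).symm
  simpa using (tendsto_inv_atTop_zero (𝕜 := ℝ)).mul (tendsto_inv_atTop_zero (𝕜 := ℝ))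

/-- The derivative of `angle - psi - w - Z / G`, multiplied by `x`. -/
noncomputable def phaseRate (x : ℝ) : ℝ :=
  3 * √5 / 2 * (H x)⁻¹ + X0 x * (Y x - √5) * ((G x)⁻¹ * (H x)⁻¹)
    + √5 * (x * x) * Y x * ((G x)⁻¹ * (H x)⁻¹)
    + 5 * (x * x) * (√5 - Y x) * ((G x)⁻¹ * (G x)⁻¹ * (H x)⁻¹)
    + 5 / 4 * Y x * (G x)⁻¹ + 5 / 4 * (x * x) * (Y x * Y x) * ((G x)⁻¹ * (G x)⁻¹)

/-- Subtracting `Z/G` cancels the order `1/x` part of the derivative, because `xZ²/G²` can be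
rewritten by the first integral. This is where the separate terms of `phaseRate` come from. -/
theorem hasDerivAt_phase {x : ℝ} (hx : 0 < x) :
    HasDerivAt (fun x => angle x - psi x - w x - Z x / G x) (phaseRate x / x) x := by
  have hG := G_pos x
  have hH := H_pos x
  have h := ((hasDerivAt_angle_sub_psi hx).sub (hasDerivAt_w x)).sub
    ((hasDerivAt_Z x).div (hasDerivAt_G x) hG.ne')
  refine h.congr_deriv ?_
  rw [phaseRate]
  have hI := first_integral x
  have hHe : H x = G x + √5 - Y x := rfl
  have hX : X0 x = (G x + x ^ 2 * Y x) / 2 := by rw [G]; ring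
  rw [hX]
  field_simp
  rw [hHe]
  linear_combination 8 * x ^ 2 * (G x + √5 - Y x) * hI - 8 * x ^ 2 * G x * sq_sqrt_five

/-- Count powers: `X₀, G, H` have order `x`, `Y` has order `1/x`, and the inverses of `G` and `H`
have order `1/x`. -/
theorem isBigO_phaseRate : phaseRate =O[atTop] fun x => x⁻¹ := by
  have hone : ∀ c : ℝ, (fun _ : ℝ => c) =O[atTop] fun _ => (1 : ℝ) := fun c =>
    Asymptotics.isBigO_const_const c one_ne_zero _
  have hid : (fun x : ℝ => x) =O[atTop] fun x => x := Asymptotics.isBigO_refl _ _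
  have hinv : (fun x : ℝ => x⁻¹) =O[atTop] fun _ => (1 : ℝ) :=
    (tendsto_inv_atTop_zero (𝕜 := ℝ)).isBigO_one ℝ
  have hY1 := isBigO_Y.trans hinv
  have hcancel : ∀ {f g : ℝ → ℝ}, f =O[atTop] g → (∀ x, x ≠ 0 → g x = x⁻¹) →
      f =O[atTop] fun x => x⁻¹ := fun h he =>
    h.trans_eventuallyEq ((eventually_ne_atTop 0).mono he)
  refine Asymptotics.IsBigO.add (Asymptotics.IsBigO.add (Asymptotics.IsBigO.add
    (Asymptotics.IsBigO.add (Asymptotics.IsBigO.add ?_ ?_) ?_) ?_) ?_) ?_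
  · exact isBigO_inv_H.const_mul_left _
  · refine hcancel ((isBigO_X0.mul (hY1.sub (hone √5))).mul (isBigO_inv_G.mul isBigO_inv_H))
      fun x hx => ?_
    field_simp
  · refine hcancel ((((hone √5).mul (hid.mul hid)).mul isBigO_Y).mul
      (isBigO_inv_G.mul isBigO_inv_H)) fun x hx => ?_
    field_simp
  · refine hcancel ((((hone 5).mul (hid.mul hid)).mul ((hone √5).sub hY1)).mul
      ((isBigO_inv_G.mul isBigO_inv_G).mul isBigO_inv_H)) fun x hx => ?_
    field_simp
  · refine hcancel (((hone (5 / 4)).mul hY1).mul isBigO_inv_G) fun x hx => ?_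
    field_simp
  · refine hcancel ((((hone (5 / 4)).mul (hid.mul hid)).mul (hY1.mul isBigO_Y)).mul
      (isBigO_inv_G.mul isBigO_inv_G)) fun x hx => ?_
    field_simp

theorem exists_tendsto_angle_sub_psi_sub_w :
    ∃ δ : ℝ, Tendsto (fun x => angle x - psi x - w x) atTop (𝓝 δ) := by
  set f : ℝ → ℝ := fun x => angle x - psi x - w x - Z x / G x
  obtain ⟨C, hC⟩ := isBigO_phaseRate.bound
  obtain ⟨a, ha⟩ := eventually_atTop.1 hC
  set R := max a 1
  have hR : (0 : ℝ) < R := lt_of_lt_of_le one_pos (le_max_right _ _)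
  have hd : ∀ x ∈ Set.Ioi R, HasDerivAt f (deriv f x) x := fun x hx =>
    (hasDerivAt_phase (hR.trans hx)).differentiableAt.hasDerivAt
  -- The derivative is `phaseRate x / x = O(x⁻²)`, hence integrable at infinity, which gives a
  -- limit.
  have hint : MeasureTheory.IntegrableOn (deriv f) (Set.Ioi R) := by
    have h1 : MeasureTheory.IntegrableOn (fun x : ℝ => C * x ^ (-2 : ℝ)) (Set.Ioi R) :=
      (integrableOn_Ioi_rpow_of_lt (by norm_num) hR).const_mul C
    refine MeasureTheory.Integrable.mono' h1 (measurable_deriv f).aestronglyMeasurable ?_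
    refine (MeasureTheory.ae_restrict_mem measurableSet_Ioi).mono fun x hx => ?_
    have hx0 : 0 < x := hR.trans hx
    have h2 := ha x ((le_max_left _ _).trans hx.le)
    rw [(hasDerivAt_phase hx0).deriv, norm_div, Real.rpow_neg hx0.le]
    rw [Real.norm_of_nonneg hx0.le, div_le_iff₀ hx0]
    refine h2.trans (le_of_eq ?_)
    rw [Real.norm_of_nonneg (inv_pos.2 hx0).le]
    norm_num
    field_simp
  have h := MeasureTheory.tendsto_limUnder_of_hasDerivAt_of_integrableOn_Ioi hd hint
  refine ⟨_, ((h.add tendsto_Z_div_G)).congr fun x => ?_⟩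
  simp only [f]; ring

/-! ### Orthonormal quadruples -/

theorem orthonormal_four_iff {a b c d : E4} : Orthonormal ℝ ![a, b, c, d] ↔
    ((inner ℝ a a = 1 ∧ inner ℝ b b = 1 ∧ inner ℝ c c = 1 ∧ inner ℝ d d = 1) ∧
    (inner ℝ a b = 0 ∧ inner ℝ a c = 0 ∧ inner ℝ a d = 0) ∧
    (inner ℝ b c = 0 ∧ inner ℝ b d = 0 ∧ inner ℝ c d = 0)) := by
  rw [orthonormal_iff_ite]
  constructor
  · intro h
    exact ⟨⟨h 0 0, h 1 1, h 2 2, h 3 3⟩, ⟨h 0 1, h 0 2, h 0 3⟩, ⟨h 1 2, h 1 3, h 2 3⟩⟩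
  · rintro ⟨⟨h1, h2, h3, h4⟩, ⟨h5, h6, h7⟩, ⟨h8, h9, h10⟩⟩ i j
    fin_cases i <;> fin_cases j <;>
      simp [-inner_self_eq_norm_sq_to_K, h1, h2, h3, h4, h5, h6, h7, h8, h9, h10,
        real_inner_comm a b, real_inner_comm a c, real_inner_comm a d, real_inner_comm b c,
        real_inner_comm b d, real_inner_comm c d]

theorem orthonormal_four_rotate {a b e f : E4} (h : Orthonormal ℝ ![a, b, e, f]) {c s : ℝ}
    (hcs : c ^ 2 + s ^ 2 = 1) : Orthonormal ℝ ![a, b, c • e + s • f, c • f - s • e] := by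
  rw [orthonormal_four_iff] at h ⊢
  obtain ⟨⟨h1, h2, h3, h4⟩, ⟨h5, h6, h7⟩, ⟨h8, h9, h10⟩⟩ := h
  have h11 := h10
  rw [real_inner_comm] at h11
  refine ⟨⟨h1, h2, ?_, ?_⟩, ⟨h5, ?_, ?_⟩, ⟨?_, ?_, ?_⟩⟩ <;>
    simp only [inner_add_left, inner_add_right, inner_sub_left, inner_sub_right,
      real_inner_smul_left, real_inner_smul_right, h3, h4, h6, h7, h8, h9, h10, h11]
  · linear_combination hcs
  · linear_combination hcs
  all_goals ring

theorem orthonormal_four_swap {a b c d : E4} (h : Orthonormal ℝ ![a, b, c, d]) :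
    Orthonormal ℝ ![c, d, a, b] := by
  rw [orthonormal_four_iff] at h ⊢
  obtain ⟨⟨h1, h2, h3, h4⟩, ⟨h5, h6, h7⟩, ⟨h8, h9, h10⟩⟩ := h
  refine ⟨⟨h3, h4, h1, h2⟩, ⟨h10, ?_, ?_⟩, ⟨?_, ?_, h5⟩⟩ <;> rwa [real_inner_comm]

theorem orthonormal_four_exchange {a b c d : E4} (h : Orthonormal ℝ ![a, b, c, d]) :
    Orthonormal ℝ ![a, c, d, b] := by
  rw [orthonormal_four_iff] at h ⊢
  obtain ⟨⟨h1, h2, h3, h4⟩, ⟨h5, h6, h7⟩, ⟨h8, h9, h10⟩⟩ := h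
  refine ⟨⟨h1, h3, h4, h2⟩, ⟨h6, h7, h5⟩, ⟨h10, ?_, ?_⟩⟩ <;> rwa [real_inner_comm]

theorem orthonormal_four_transpose {a b c d : E4} (h : Orthonormal ℝ ![a, b, c, d]) :
    Orthonormal ℝ ![a, c, b, d] := by
  rw [orthonormal_four_iff] at h ⊢
  obtain ⟨⟨h1, h2, h3, h4⟩, ⟨h5, h6, h7⟩, ⟨h8, h9, h10⟩⟩ := h
  exact ⟨⟨h1, h3, h2, h4⟩, ⟨h6, h5, h7⟩, ⟨by rwa [real_inner_comm], h10, h9⟩⟩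

theorem orthonormal_four_eq_zero {a b c d v : E4} (h : Orthonormal ℝ ![a, b, c, d])
    (ha : inner ℝ a v = 0) (hb : inner ℝ b v = 0) (hc : inner ℝ c v = 0) (hd : inner ℝ d v = 0) :
    v = 0 := by
  have hsp := h.linearIndependent.span_eq_top_of_card_eq_finrank' (by simp)
  have hv : v ∈ (Submodule.span ℝ (Set.range ![a, b, c, d]))ᗮ := by
    rw [Submodule.mem_orthogonal]
    intro w hw
    induction hw using Submodule.span_induction with
    | mem w hw =>
      obtain ⟨i, rfl⟩ := hw
      fin_cases i <;> assumption
    | zero => simp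
    | add x y _ _ hx hy => rw [inner_add_left, hx, hy, add_zero]
    | smul k x _ hx => rw [real_inner_smul_left, hx, mul_zero]
  rwa [hsp, Submodule.top_orthogonal_eq_bot, Submodule.mem_bot] at hv

theorem inner_deriv_add_eq_zero {f g : ℝ → E4} {f' g' : E4} {c x : ℝ} (hx : 0 < x)
    (hfg : ∀ x, 0 < x → inner ℝ (f x) (g x) = c) (hf : HasDerivAt f f' x)
    (hg : HasDerivAt g g' x) : inner ℝ (f x) g' + inner ℝ f' (g x) = 0 := by
  have h1 := hf.inner ℝ hg
  have h2 : HasDerivAt (fun x => inner ℝ (f x) (g x)) (0 : ℝ) x :=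
    (hasDerivAt_const x c).congr_of_eventuallyEq ((eventually_gt_nhds hx).mono fun z hz => hfg z hz)
  exact h1.unique h2

theorem eq_of_hasDerivAt_zero {f : ℝ → E4} (hf : ∀ x, 0 < x → HasDerivAt f 0 x) {x x' : ℝ}
    (hx : 0 < x) (hx' : 0 < x') : f x = f x' :=
  isOpen_Ioi.is_const_of_deriv_eq_zero (convex_Ioi (0 : ℝ)).isPreconnected
    (fun z hz => (hf z hz).differentiableAt.differentiableWithinAt)
    (fun z hz => (hf z hz).deriv) hx hx'

/-! ### The coefficients of the connection form -/

/-- `h`, extended to all `x` -/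
noncomputable def hG (x y : ℝ) : ℝ := G x + √5 + y ^ 2 * Y x

theorem hG_pos (x y : ℝ) : 0 < hG x y := by
  have := G_pos x; have := Y_pos x; unfold hG; positivity

theorem h_eq {x : ℝ} (hx : 0 < x) (y : ℝ) : h x y = hG x y := by
  rw [h, hG, dX0_eq, G]; field_simp; ring

theorem c₁_eq {x : ℝ} (hx : 0 < x) (y : ℝ) : c₁ x y = -(2 * X0 x + √5) / (x * hG x y) := by
  have := hG_pos x y
  rw [c₁, h_eq hx]; field_simp

theorem a₁_eq (x y : ℝ) : a₁ x y = -y * c₁ x y := by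
  rw [a₁, c₁]; ring

theorem b₁_eq {x : ℝ} (hx : 0 < x) (y : ℝ) :
    b₁ x y = -(2 * X0 x + √5 + 2 * √5 * (x ^ 2 - y ^ 2)) / (2 * x * hG x y) := by
  have := hG_pos x y
  rw [b₁, h_eq hx]; field_simp

theorem a₂_eq {x : ℝ} (hx : 0 < x) (y : ℝ) : a₂ x y = 2 * y ^ 2 * Y x / hG x y - 1 := by
  have := hG_pos x y
  rw [a₂, h_eq hx, dX0_eq]; field_simp; rw [hG, G]; ring

theorem b₂_eq {x : ℝ} (hx : 0 < x) (y : ℝ) : b₂ x y = -y * (Y x + 2 * √5) / hG x y := by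
  have := hG_pos x y
  rw [b₂, h_eq hx, dX0_eq]; field_simp

theorem ddX0_eq (x : ℝ) : ddX0 x = Y x + Z x := by
  have h := (hasDerivAt_id x).mul (hasDerivAt_Y x)
  have e : dX0 = id * Y := funext dX0_eq
  rw [ddX0, e, h.deriv]
  rcases eq_or_ne x 0 with rfl | hx
  · simp [Z_zero]
  · simp only [id]; field_simp

theorem c₂_eq {x : ℝ} (hx : 0 < x) (y : ℝ) : c₂ x y = 2 * y * Z x / hG x y := by
  have := hG_pos x y
  rw [c₂, h_eq hx, dX0_eq, ddX0_eq]; field_simp; ring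

/-- `1 - ⟨n, -v₁⟩` -/
noncomputable def kappa (x y : ℝ) : ℝ := 2 * (1 + y ^ 2) * Y x / hG x y

/-- The distance of `n` from the axis `v₁`. -/
noncomputable def axisDist (x y : ℝ) : ℝ := √(1 + y ^ 2) * rho x / hG x y

theorem sqrt_pos' (y : ℝ) : 0 < √(1 + y ^ 2) := Real.sqrt_pos.2 (by positivity)

theorem sq_sqrt' (y : ℝ) : √(1 + y ^ 2) ^ 2 = 1 + y ^ 2 := Real.sq_sqrt (by positivity)

theorem kappa_pos (x y : ℝ) : 0 < kappa x y := by
  have := hG_pos x y; have := Y_pos x; unfold kappa; positivity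

theorem axisDist_pos (x y : ℝ) : 0 < axisDist x y := by
  have := hG_pos x y; have := rho_pos x; have := sqrt_pos' y; unfold axisDist; positivity

theorem hG_eq (x y : ℝ) : hG x y = H x + (1 + y ^ 2) * Y x := by rw [hG, H]; ring

/-- Equivalent to `hG = H + (1 + y²) Y`; it allows `axisDist` and `κ - 1` to serve as the entries of
a rotation. -/
theorem axisDist_sq_add (x y : ℝ) : axisDist x y ^ 2 + (kappa x y - 1) ^ 2 = 1 := by
  have := hG_pos x y
  rw [axisDist, kappa, div_pow, mul_pow, sq_sqrt', rho_sq]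
  field_simp
  rw [hG_eq]; ring

theorem axisDist_mul_cosPsi (x y : ℝ) :
    axisDist x y * cosPsi x = √(1 + y ^ 2) * (Y x + 2 * √5) / hG x y := by
  have := hG_pos x y; have := rho_pos x
  rw [axisDist, cosPsi]; field_simp

theorem axisDist_mul_sinPsi (x y : ℝ) :
    axisDist x y * sinPsi x = √(1 + y ^ 2) * (2 * Z x) / hG x y := by
  have := hG_pos x y; have := rho_pos x
  rw [axisDist, sinPsi]; field_simp

theorem K_div_mul_axisDist {x : ℝ} (hx : 0 < x) (y : ℝ) :
    K x / x * axisDist x y = -(√(1 + y ^ 2) * c₁ x y * cosPsi x) := by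
  have := hG_pos x y; have := rho_pos x; have := Y_pos x; have := H_pos x
  rw [c₁_eq hx, K, axisDist, cosPsi, ← rho_sq]; field_simp

/-- Both terms on the right have the pole in `H` or `hG`; their sum gives the rotation speed of `ψ`
against the frame, as needed for `hasDerivAt_psi`. -/
theorem K_div_mul_kappa {x : ℝ} (hx : 0 < x) (y : ℝ) :
    K x / x * kappa x y =
      (3 * √5 + x ^ 2 * Y x + 2 * √5 * x ^ 2 + G x) / (2 * x * H x) + b₁ x y := by
  have h1 := hG_pos x y; have := Y_pos x; have := H_pos x
  rw [b₁_eq hx, K, kappa]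
  have hX : X0 x = (G x + x ^ 2 * Y x) / 2 := by rw [G]; ring
  rw [hX]
  rw [hG_eq] at h1 ⊢
  field_simp
  rw [show G x = H x + Y x - √5 by rw [H]; ring]
  ring

namespace CurvatureSurface

variable (S : CurvatureSurface)

/-! ### Derivatives of the frame -/

theorem hasDerivAt_F_fst {x : ℝ} (hx : 0 < x) (y : ℝ) (j : Fin 4) :
    HasDerivAt (fun x => S.F j (x, y)) (∑ i, Ω₁ x y i j • S.F i (x, y)) x := by
  have h := (S.dF (x, y) hx j).comp_hasDerivAt x ((hasDerivAt_id x).prodMk (hasDerivAt_const x y))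
  refine h.congr_deriv ?_
  simp

theorem hasDerivAt_F_snd {x : ℝ} (hx : 0 < x) (y : ℝ) (j : Fin 4) :
    HasDerivAt (fun y => S.F j (x, y)) (∑ i, Ω₂ x y i j • S.F i (x, y)) y := by
  have h := (S.dF (x, y) hx j).comp_hasDerivAt y ((hasDerivAt_const y x).prodMk (hasDerivAt_id y))
  refine h.congr_deriv ?_
  simp

theorem hasDerivAt_φ_fst {x : ℝ} (hx : 0 < x) (y : ℝ) :
    HasDerivAt (fun x => S.φ x y) ((y * c₁ x y) • S.Xα x y) x := by
  refine (S.hasDerivAt_F_fst hx y 0).congr_deriv ?_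
  simp [Fin.sum_univ_four, Ω₁, Xα, a₁_eq]

theorem hasDerivAt_Xα_fst {x : ℝ} (hx : 0 < x) (y : ℝ) :
    HasDerivAt (fun x => S.Xα x y)
      (-(√(1 + y ^ 2) * c₁ x y) • S.n x y - b₁ x y • S.ξ x y) x := by
  refine (S.hasDerivAt_F_fst hx y 1).congr_deriv ?_
  have := sqrt_pos' y
  simp only [Fin.sum_univ_four, Ω₁, n, Xβ, φ, ξ, a₁_eq]
  simp
  match_scalars <;> field_simp

theorem hasDerivAt_Xβ_fst {x : ℝ} (hx : 0 < x) (y : ℝ) :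
    HasDerivAt (fun x => S.Xβ x y) (c₁ x y • S.Xα x y) x := by
  refine (S.hasDerivAt_F_fst hx y 2).congr_deriv ?_
  simp [Fin.sum_univ_four, Ω₁, Xα]

theorem hasDerivAt_ξ_fst {x : ℝ} (hx : 0 < x) (y : ℝ) :
    HasDerivAt (fun x => S.ξ x y) (b₁ x y • S.Xα x y) x := by
  refine (S.hasDerivAt_F_fst hx y 3).congr_deriv ?_
  simp [Fin.sum_univ_four, Ω₁, Xα]

theorem hasDerivAt_φ_snd {x : ℝ} (hx : 0 < x) (y : ℝ) :
    HasDerivAt (fun y => S.φ x y) (-a₂ x y • S.Xβ x y) y := by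
  refine (S.hasDerivAt_F_snd hx y 0).congr_deriv ?_
  simp [Fin.sum_univ_four, Ω₂, Xβ]

theorem hasDerivAt_Xα_snd {x : ℝ} (hx : 0 < x) (y : ℝ) :
    HasDerivAt (fun y => S.Xα x y) (c₂ x y • S.Xβ x y) y := by
  refine (S.hasDerivAt_F_snd hx y 1).congr_deriv ?_
  simp [Fin.sum_univ_four, Ω₂, Xβ]

theorem hasDerivAt_Xβ_snd {x : ℝ} (hx : 0 < x) (y : ℝ) :
    HasDerivAt (fun y => S.Xβ x y)
      (a₂ x y • S.φ x y - c₂ x y • S.Xα x y - b₂ x y • S.ξ x y) y := by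
  refine (S.hasDerivAt_F_snd hx y 2).congr_deriv ?_
  simp [Fin.sum_univ_four, Ω₂, Xα, φ, ξ, sub_eq_add_neg]

theorem hasDerivAt_ξ_snd {x : ℝ} (hx : 0 < x) (y : ℝ) :
    HasDerivAt (fun y => S.ξ x y) (b₂ x y • S.Xβ x y) y := by
  refine (S.hasDerivAt_F_snd hx y 3).congr_deriv ?_
  simp [Fin.sum_univ_four, Ω₂, Xβ]

theorem hasDerivAt_n_fst {x : ℝ} (hx : 0 < x) (y : ℝ) :
    HasDerivAt (fun x => S.n x y) ((√(1 + y ^ 2) * c₁ x y) • S.Xα x y) x := by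
  refine (((S.hasDerivAt_Xβ_fst hx y).add
    ((S.hasDerivAt_φ_fst hx y).const_smul y)).const_smul (√(1 + y ^ 2))⁻¹).congr_deriv ?_
  have := sqrt_pos' y
  have := sq_sqrt' y
  match_scalars
  field_simp
  linear_combination (-c₁ x y) * this

/-! ### The adapted frame -/

/-- The normal `u` of the hyperplane containing `x ↦ f (x, y)`. -/
noncomputable def uVec (x y : ℝ) : E4 := (√(1 + y ^ 2))⁻¹ • (y • S.Xβ x y - S.φ x y)

/-- The part of the adapted frame which is orthogonal to `u` and to the axis and
lies in the span of `X⁰_α` and `ξ`. -/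
noncomputable def qVec (x y : ℝ) : E4 := cosPsi x • S.Xα x y + sinPsi x • S.ξ x y

/-- The vector in the span of `X⁰_α` and `ξ` orthogonal to `qVec`. -/
noncomputable def mVec (x y : ℝ) : E4 := cosPsi x • S.ξ x y - sinPsi x • S.Xα x y

/-- The axis `v₁`. -/
noncomputable def vVec (x y : ℝ) : E4 :=
  axisDist x y • S.mVec x y + (kappa x y - 1) • S.n x y

/-- The direction of the projection of `n` to the orthogonal complement of `u`, `v₁`. -/
noncomputable def pVec (x y : ℝ) : E4 :=
  axisDist x y • S.n x y - (kappa x y - 1) • S.mVec x y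

theorem orthonormal_F {x : ℝ} (hx : 0 < x) (y : ℝ) :
    Orthonormal ℝ ![S.φ x y, S.Xα x y, S.Xβ x y, S.ξ x y] := by
  have h := S.orthonormal (x, y) hx
  convert h using 1
  ext1 j
  fin_cases j <;> rfl

/-- Three plane rotations of the given frame: `X⁰_α, ξ` to `q, m`, then `X⁰_β, φ` to `u, n`, then
`m, n` to `v, p`. -/
theorem orthonormal_adapted {x : ℝ} (hx : 0 < x) (y : ℝ) :
    Orthonormal ℝ ![S.uVec x y, S.vVec x y, S.qVec x y, S.pVec x y] := by
  have hs := sqrt_pos' y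
  have h1 := orthonormal_four_rotate (orthonormal_four_exchange (orthonormal_four_swap
    (S.orthonormal_F hx y))) (cosPsi_sq_add_sinPsi_sq x)
  have h2 := orthonormal_four_rotate (orthonormal_four_swap h1)
    (c := y / √(1 + y ^ 2)) (s := -1 / √(1 + y ^ 2)) (by field_simp; rw [sq_sqrt']; ring)
  have h3 := orthonormal_four_rotate (orthonormal_four_exchange (orthonormal_four_swap h2))
    (axisDist_sq_add x y)
  have hu : S.uVec x y = (y / √(1 + y ^ 2)) • S.Xβ x y + (-1 / √(1 + y ^ 2)) • S.φ x y := by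
    rw [uVec]; module
  have hn : S.n x y = (y / √(1 + y ^ 2)) • S.φ x y - (-1 / √(1 + y ^ 2)) • S.Xβ x y := by
    rw [n]; module
  rw [← hu, ← hn] at h3
  exact orthonormal_four_transpose h3

theorem hasDerivAt_uVec_fst {x : ℝ} (hx : 0 < x) (y : ℝ) :
    HasDerivAt (fun x => S.uVec x y) 0 x := by
  refine ((((S.hasDerivAt_Xβ_fst hx y).const_smul y).sub
    (S.hasDerivAt_φ_fst hx y)).const_smul (√(1 + y ^ 2))⁻¹).congr_deriv ?_
  module

theorem hasDerivAt_sqrt' (y : ℝ) :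
    HasDerivAt (fun y => (√(1 + y ^ 2))⁻¹) (-(y / √(1 + y ^ 2) ^ 3)) y := by
  have := sqrt_pos' y
  have h := (((hasDerivAt_pow 2 y).const_add 1).sqrt (by positivity)).inv this.ne'
  refine h.congr_deriv ?_
  norm_num
  field_simp

/-- This computation identifies the axis: the unit vector along `∂u/∂y` has component `κ - 1` along
`n` and `axisDist` along `m`. -/
theorem hasDerivAt_uVec_snd {x : ℝ} (hx : 0 < x) (y : ℝ) :
    HasDerivAt (fun y => S.uVec x y) ((y ^ 2 / (1 + y ^ 2)) • S.vVec x y) y := by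
  refine ((hasDerivAt_sqrt' y).smul (((hasDerivAt_id y).smul (S.hasDerivAt_Xβ_snd hx y)).sub
    (S.hasDerivAt_φ_snd hx y))).congr_deriv ?_
  have hs := sqrt_pos' y
  have hs2 := sq_sqrt' y
  have hh := hG_pos x y
  have h1 := axisDist_mul_cosPsi x y
  have h2 := axisDist_mul_sinPsi x y
  rw [vVec, mVec, n, smul_sub (axisDist x y), smul_smul (axisDist x y) (cosPsi x),
    smul_smul (axisDist x y) (sinPsi x), h1, h2, a₂_eq hx, b₂_eq hx, c₂_eq hx, kappa]
  set s := √(1 + y ^ 2)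
  rw [← hs2]
  simp only [id, Pi.smul_apply', Pi.sub_apply]
  match_scalars
  all_goals field_simp
  · linear_combination -y * hG x y * hs2
  · ring

/-- `ψ` is chosen for `c₂ cos ψ + b₂ sin ψ = 0`; the ratio `c₂ : b₂` does not depend on `y` for `y ≠
0`. -/
theorem hasDerivAt_qVec_snd {x : ℝ} (hx : 0 < x) (y : ℝ) :
    HasDerivAt (fun y => S.qVec x y) 0 y := by
  refine (((S.hasDerivAt_Xα_snd hx y).const_smul (cosPsi x)).add
    ((S.hasDerivAt_ξ_snd hx y).const_smul (sinPsi x))).congr_deriv ?_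
  have hr := rho_pos x
  have hh := hG_pos x y
  rw [c₂_eq hx, b₂_eq hx, cosPsi, sinPsi]
  match_scalars
  field_simp
  ring

/-- Although `ψ` depends on `x` only, its derivative is written with `y`, so that the component of
`∂q/∂x` along `m` becomes that of `(K/x) p`. -/
theorem hasDerivAt_psi {x : ℝ} (hx : 0 < x) :
    HasDerivAt psi (b₁ x y - K x / x * (kappa x y - 1)) x := by
  have h := (hasDerivAt_angle hx).sub (hasDerivAt_angle_sub_psi hx)
  have e : angle - (fun x => angle x - psi x) = psi := by ext; simp
  rw [e] at h
  refine h.congr_deriv ?_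
  linear_combination K_div_mul_kappa hx y

theorem hasDerivAt_qVec_fst {x : ℝ} (hx : 0 < x) (y : ℝ) :
    HasDerivAt (fun x => S.qVec x y) ((K x / x) • S.pVec x y) x := by
  have hpsi := hasDerivAt_psi (y := y) hx
  have hc : HasDerivAt cosPsi (-sinPsi x * (b₁ x y - K x / x * (kappa x y - 1))) x := by
    have := hpsi.cos
    simpa only [cos_psi, sin_psi] using this
  have hsn : HasDerivAt sinPsi (cosPsi x * (b₁ x y - K x / x * (kappa x y - 1))) x := by
    have := hpsi.sin
    simpa only [cos_psi, sin_psi] using this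
  refine ((hc.smul (S.hasDerivAt_Xα_fst hx y)).add
    (hsn.smul (S.hasDerivAt_ξ_fst hx y))).congr_deriv ?_
  rw [pVec, smul_sub (K x / x), smul_smul (K x / x) (axisDist x y), K_div_mul_axisDist hx, mVec]
  match_scalars <;> ring

end CurvatureSurface

/-! ### Norm estimates and bounds for `kappa`, `axisDist` and `angle` -/

theorem norm_sq_smul_add_smul {e f : E4} (he : inner ℝ e e = (1 : ℝ)) (hf : inner ℝ f f = (1 : ℝ))
    (hef : inner ℝ e f = (0 : ℝ)) (a b : ℝ) : ‖a • e + b • f‖ ^ 2 = a ^ 2 + b ^ 2 := by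
  have hfe := hef
  rw [real_inner_comm] at hfe
  rw [← real_inner_self_eq_norm_sq]
  simp only [inner_add_left, inner_add_right, real_inner_smul_left, real_inner_smul_right,
    he, hf, hef, hfe]
  ring

theorem norm_circle_sub_le {e f : E4} (he : ‖e‖ = 1) (hf : ‖f‖ = 1) (a b : ℝ) :
    ‖(Real.cos a • e + Real.sin a • f) - (Real.cos b • e + Real.sin b • f)‖ ≤ 2 * |a - b| := by
  have h1 : |Real.cos a - Real.cos b| ≤ |a - b| := by
    simpa [Real.dist_eq] using Real.lipschitzWith_cos.dist_le_mul a b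
  have h2 : |Real.sin a - Real.sin b| ≤ |a - b| := by
    simpa [Real.dist_eq] using Real.lipschitzWith_sin.dist_le_mul a b
  calc _ = ‖(Real.cos a - Real.cos b) • e + (Real.sin a - Real.sin b) • f‖ := by
        congr 1; module
    _ ≤ ‖(Real.cos a - Real.cos b) • e‖ + ‖(Real.sin a - Real.sin b) • f‖ := norm_add_le _ _
    _ ≤ _ := by rw [norm_smul, norm_smul, he, hf, Real.norm_eq_abs, Real.norm_eq_abs]; linarith

theorem tendstoUniformlyOn_zero_of_norm_le {F : ℝ → ℝ → E4} {K : Set ℝ} {b : ℝ → ℝ}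
    (h : ∀ᶠ x in atTop, ∀ y ∈ K, ‖F x y‖ ≤ b x) (hb : Tendsto b atTop (𝓝 0)) :
    TendstoUniformlyOn F (fun _ => 0) atTop K := by
  rw [Metric.tendstoUniformlyOn_iff]
  intro ε hε
  filter_upwards [h, hb.eventually (gt_mem_nhds hε)] with x hx hxb y hy
  rw [dist_zero_left]
  exact (hx y hy).trans_lt hxb

theorem norm_smul_eq_radius {e f : E4} (he : inner ℝ e e = (1 : ℝ)) (hf : inner ℝ f f = (1 : ℝ))
    (hef : inner ℝ e f = (0 : ℝ)) (y : ℝ) :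
    ‖(2 * √5)⁻¹ • ((√(1 + y ^ 2))⁻¹ • e + (2 : ℝ) • f)‖ = radius y := by
  rw [norm_smul, radius, Real.norm_of_nonneg (by positivity)]
  congr 1
  rw [eq_comm, Real.sqrt_eq_iff_mul_self_eq (by positivity) (norm_nonneg _), ← pow_two,
    norm_sq_smul_add_smul he hf hef, inv_pow, sq_sqrt']
  field_simp
  ring

theorem kappa_le (x : ℝ) {y R : ℝ} (hy : |y| ≤ R) :
    kappa x y ≤ 2 * (1 + R ^ 2) * (Y x / G x) := by
  have hGx := G_pos x
  have hY := Y_pos x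
  have h1 : y ^ 2 ≤ R ^ 2 := sq_le_sq' (abs_le.1 hy).1 (abs_le.1 hy).2
  have h2 : G x ≤ hG x y := by
    have : 0 ≤ √5 := Real.sqrt_nonneg _
    rw [hG]; nlinarith [mul_nonneg (sq_nonneg y) hY.le]
  rw [kappa, ← mul_div_assoc]
  gcongr

/-- The numerator is at least `2√5` because `rho² ≥ (Y + 2√5)²`, and `hG` grows at most linearly. -/
theorem exists_pos_div_le_axisDist (y : ℝ) :
    ∃ c : ℝ, 0 < c ∧ ∀ x, 1 ≤ x → c / x ≤ axisDist x y := by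
  obtain ⟨m, M, hm, hM, h⟩ := exists_bounds
  refine ⟨2 * √5 / (M + √5 + y ^ 2 * M), by positivity, fun x hx => ?_⟩
  obtain ⟨-, h2, -, h4, -⟩ := h x hx
  have hx0 : 0 < x := by linarith
  have hY := Y_pos x
  have h5 : 0 < √5 := by positivity
  have hYM : Y x ≤ M := by nlinarith
  have hrho : 2 * √5 ≤ rho x := by
    have h6 := rho_sq x
    rw [four_mul_Y_mul_H] at h6
    nlinarith [rho_pos x, sq_nonneg (2 * Z x)]
  have hs : 1 ≤ √(1 + y ^ 2) := by
    rw [Real.one_le_sqrt]; nlinarith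
  have hh : hG x y ≤ (M + √5 + y ^ 2 * M) * x := by
    have : y ^ 2 * Y x ≤ y ^ 2 * M * x := by
      rw [mul_assoc]; exact mul_le_mul_of_nonneg_left (by nlinarith) (sq_nonneg y)
    rw [hG]; nlinarith
  rw [div_div, axisDist]
  have := hG_pos x y
  have h6 := rho_pos x
  exact div_le_div₀ (by positivity) (hrho.trans (le_mul_of_one_le_left h6.le hs)) this hh

theorem angle_bounds : ∃ m M : ℝ, 0 < m ∧ m ≤ M ∧ ∀ x x', 1 ≤ x → x ≤ x' →
    m * (x' - x) ≤ angle x' - angle x ∧ angle x' - angle x ≤ M * (x' - x) := by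
  obtain ⟨m, M, hm, h⟩ := exists_bounds_angle
  have hd : ∀ x, 1 ≤ x → HasDerivAt angle (K x / x) x := fun x hx => hasDerivAt_angle (by linarith)
  have hc : ContinuousOn angle (Set.Ici 1) := fun x hx =>
    (hd x hx).continuousAt.continuousWithinAt
  have hdiff : DifferentiableOn ℝ angle (interior (Set.Ici 1)) := fun x hx =>
    (hd x (interior_subset hx)).differentiableAt.differentiableWithinAt
  refine ⟨m, M, hm, (h 1 le_rfl).1.trans (h 1 le_rfl).2, fun x x' hx hxx' => ⟨?_, ?_⟩⟩
  · refine (convex_Ici 1).mul_sub_le_image_sub_of_le_deriv hc hdiff (fun z hz => ?_) x hx x'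
      (hx.trans hxx') hxx'
    rw [(hd z (interior_subset hz)).deriv]
    exact (h z (interior_subset hz)).1
  · refine (convex_Ici 1).image_sub_le_mul_sub_of_deriv_le hc hdiff (fun z hz => ?_) x hx x'
      (hx.trans hxx') hxx'
    rw [(hd z (interior_subset hz)).deriv]
    exact (h z (interior_subset hz)).2

namespace CurvatureSurface

variable (S : CurvatureSurface)

theorem orthonormal_u_n {x : ℝ} (hx : 0 < x) (y : ℝ) :
    Orthonormal ℝ ![S.Xα x y, S.ξ x y, S.uVec x y, S.n x y] := by
  have hs := sqrt_pos' y
  have h2 := orthonormal_four_rotate (orthonormal_four_swap (orthonormal_four_exchange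
    (orthonormal_four_swap (S.orthonormal_F hx y))))
    (c := y / √(1 + y ^ 2)) (s := -1 / √(1 + y ^ 2)) (by field_simp; rw [sq_sqrt']; ring)
  have hu : S.uVec x y = (y / √(1 + y ^ 2)) • S.Xβ x y + (-1 / √(1 + y ^ 2)) • S.φ x y := by
    rw [uVec]; module
  have hn : S.n x y = (y / √(1 + y ^ 2)) • S.φ x y - (-1 / √(1 + y ^ 2)) • S.Xβ x y := by
    rw [n]; module
  rwa [← hu, ← hn] at h2

/-! ### Independence of the adapted frame of one of the variables -/

theorem uVec_eq {x : ℝ} (hx : 0 < x) (y : ℝ) : S.uVec x y = S.uVec 1 y :=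
  eq_of_hasDerivAt_zero (f := fun x => S.uVec x y) (fun _ hz => S.hasDerivAt_uVec_fst hz y) hx
    one_pos

theorem qVec_eq {x : ℝ} (hx : 0 < x) (y : ℝ) : S.qVec x y = S.qVec x 0 :=
  is_const_of_deriv_eq_zero (fun z => (S.hasDerivAt_qVec_snd hx z).differentiableAt)
    (fun z => (S.hasDerivAt_qVec_snd hx z).deriv) y 0

/-- Inherited from `q`, since `∂q/∂x = (K/x) p` and the factor is nonzero and free of `y`. -/
theorem pVec_eq {x : ℝ} (hx : 0 < x) (y : ℝ) : S.pVec x y = S.pVec x 0 := by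
  have h1 := (S.hasDerivAt_qVec_fst hx y).congr_of_eventuallyEq
    ((eventually_gt_nhds hx).mono fun z hz => (S.qVec_eq hz y).symm)
  have h2 := h1.unique (S.hasDerivAt_qVec_fst hx 0)
  exact smul_right_injective E4 (div_pos (K_pos x) hx).ne' h2

theorem continuous_n_snd {x : ℝ} (hx : 0 < x) : Continuous fun y => S.n x y := by
  have h1 : Continuous fun y => S.Xβ x y :=
    continuous_iff_continuousAt.2 fun y => (S.hasDerivAt_Xβ_snd hx y).continuousAt
  have h2 : Continuous fun y => S.φ x y :=
    continuous_iff_continuousAt.2 fun y => (S.hasDerivAt_φ_snd hx y).continuousAt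
  have h3 : Continuous fun y : ℝ => (√(1 + y ^ 2))⁻¹ :=
    continuous_iff_continuousAt.2 fun y => (hasDerivAt_sqrt' y).continuousAt
  exact h3.smul (h1.add (continuous_id.smul h2))

theorem continuous_vVec_snd {x : ℝ} (hx : 0 < x) : Continuous fun y => S.vVec x y := by
  have h1 : Continuous fun y => S.Xα x y :=
    continuous_iff_continuousAt.2 fun y => (S.hasDerivAt_Xα_snd hx y).continuousAt
  have h2 : Continuous fun y => S.ξ x y :=
    continuous_iff_continuousAt.2 fun y => (S.hasDerivAt_ξ_snd hx y).continuousAt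
  have h3 : Continuous fun y => hG x y := by unfold hG; fun_prop
  have h4 : Continuous fun y => axisDist x y := by
    unfold axisDist
    exact Continuous.div (by fun_prop) h3 fun y => (hG_pos x y).ne'
  have h5 : Continuous fun y => kappa x y := by
    unfold kappa
    exact Continuous.div (by fun_prop) h3 fun y => (hG_pos x y).ne'
  have h6 := S.continuous_n_snd hx
  unfold vVec mVec
  fun_prop

/-- For `y ≠ 0` the axis is determined by `∂u/∂y`, and `u` is independent of `x`. The factor `y²/(1
+ y²)` vanishes at `y = 0`, where continuity takes over. -/
theorem vVec_eq {x : ℝ} (hx : 0 < x) (y : ℝ) : S.vVec x y = S.vVec 1 y := by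
  refine congrFun ((S.continuous_vVec_snd hx).ext_on (dense_compl_singleton (0 : ℝ))
    (S.continuous_vVec_snd one_pos) fun z hz => ?_) y
  have hz : z ≠ 0 := hz
  have h1 : (fun y => S.uVec x y) = fun y => S.uVec 1 y := funext fun y => S.uVec_eq hx y
  have h2 := S.hasDerivAt_uVec_snd hx z
  rw [h1] at h2
  exact smul_right_injective _ (by positivity : z ^ 2 / (1 + z ^ 2) ≠ 0)
    (h2.unique (S.hasDerivAt_uVec_snd one_pos z))

theorem differentiableAt_pVec {x : ℝ} (hx : 0 < x) :
    DifferentiableAt ℝ (fun x => S.pVec x 0) x := by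
  have h1 : Differentiable ℝ fun x => hG x 0 := by
    unfold hG
    have := differentiable_G; have := differentiable_Y
    fun_prop
  have h2 : DifferentiableAt ℝ (fun x => axisDist x 0) x :=
    ((differentiable_rho x).const_mul _).div (h1 x) (hG_pos x 0).ne'
  have h3 : DifferentiableAt ℝ (fun x => kappa x 0) x :=
    ((differentiable_Y x).const_mul _).div (h1 x) (hG_pos x 0).ne'
  exact (h2.smul (S.hasDerivAt_n_fst hx 0).differentiableAt).sub ((h3.sub_const 1).smul
    (((differentiable_cosPsi x).smul (S.hasDerivAt_ξ_fst hx 0).differentiableAt).sub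
      ((differentiable_sinPsi x).smul (S.hasDerivAt_Xα_fst hx 0).differentiableAt)))

/-- Differentiating the orthonormality relations with `u` and `v` fixed and `q' = (K/x) p` leaves
only this value. -/
theorem hasDerivAt_pVec {x : ℝ} (hx : 0 < x) :
    HasDerivAt (fun x => S.pVec x 0) (-(K x / x) • S.qVec x 0) x := by
  have hp := (S.differentiableAt_pVec hx).hasDerivAt
  set p' := deriv (fun x => S.pVec x 0) x
  have hon := fun z (hz : 0 < z) => orthonormal_four_iff.1 (S.orthonormal_adapted hz 0)
  obtain ⟨⟨-, -, e3, e4⟩, ⟨-, e6, e7⟩, ⟨e8, e9, e10⟩⟩ := hon x hx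
  have hv : HasDerivAt (fun x => S.vVec x 0) 0 x :=
    (hasDerivAt_const x (S.vVec 1 0)).congr_of_eventuallyEq
      ((eventually_gt_nhds hx).mono fun z hz => S.vVec_eq hz 0)
  have d1 := inner_deriv_add_eq_zero hx (fun z hz => (hon z hz).2.1.2.2)
    (S.hasDerivAt_uVec_fst hx 0) hp
  have d2 := inner_deriv_add_eq_zero hx (fun z hz => (hon z hz).2.2.2.1) hv hp
  have d3 := inner_deriv_add_eq_zero hx (fun z hz => (hon z hz).2.2.2.2)
    (S.hasDerivAt_qVec_fst hx 0) hp
  have d4 := inner_deriv_add_eq_zero hx (fun z hz => (hon z hz).1.2.2.2) hp hp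
  rw [real_inner_comm (S.pVec x 0) p'] at d4
  rw [inner_zero_left, add_zero] at d1 d2
  rw [real_inner_smul_left, e4] at d3
  have hz : p' + (K x / x) • S.qVec x 0 = 0 := by
    refine orthonormal_four_eq_zero (S.orthonormal_adapted hx 0) ?_ ?_ ?_ ?_ <;>
      rw [inner_add_right, real_inner_smul_right]
    · rw [d1, e6]; ring
    · rw [d2, e8]; ring
    · rw [e3]; linarith
    · rw [real_inner_comm (S.qVec x 0), e10]; linarith
  rwa [eq_neg_of_add_eq_zero_left hz, ← neg_smul] at hp

/-! ### The constant vectors `b^∞`, `c^∞` -/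

/-- `b^∞` -/
noncomputable def bInf : E4 := Real.cos (angle 1) • S.qVec 1 0 - Real.sin (angle 1) • S.pVec 1 0

/-- `c^∞` -/
noncomputable def cInf : E4 := Real.sin (angle 1) • S.qVec 1 0 + Real.cos (angle 1) • S.pVec 1 0

theorem bInf_eq {x : ℝ} (hx : 0 < x) :
    S.bInf = Real.cos (angle x) • S.qVec x 0 - Real.sin (angle x) • S.pVec x 0 := by
  refine eq_of_hasDerivAt_zero (f := fun x =>
    Real.cos (angle x) • S.qVec x 0 - Real.sin (angle x) • S.pVec x 0) (fun z hz => ?_) one_pos hx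
  refine (((hasDerivAt_angle hz).cos.smul (S.hasDerivAt_qVec_fst hz 0)).sub
    ((hasDerivAt_angle hz).sin.smul (S.hasDerivAt_pVec hz))).congr_deriv ?_
  module

theorem cInf_eq {x : ℝ} (hx : 0 < x) :
    S.cInf = Real.sin (angle x) • S.qVec x 0 + Real.cos (angle x) • S.pVec x 0 := by
  refine eq_of_hasDerivAt_zero (f := fun x =>
    Real.sin (angle x) • S.qVec x 0 + Real.cos (angle x) • S.pVec x 0) (fun z hz => ?_) one_pos hx
  refine (((hasDerivAt_angle hz).sin.smul (S.hasDerivAt_qVec_fst hz 0)).add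
    ((hasDerivAt_angle hz).cos.smul (S.hasDerivAt_pVec hz))).congr_deriv ?_
  module

theorem qVec_eq_circle {x : ℝ} (hx : 0 < x) (y : ℝ) :
    S.qVec x y = Real.cos (angle x) • S.bInf + Real.sin (angle x) • S.cInf := by
  rw [S.qVec_eq hx, S.bInf_eq hx, S.cInf_eq hx]
  have := Real.cos_sq_add_sin_sq (angle x)
  match_scalars
  · linear_combination -this
  · ring

theorem pVec_eq_circle {x : ℝ} (hx : 0 < x) (y : ℝ) :
    S.pVec x y = Real.cos (angle x) • S.cInf - Real.sin (angle x) • S.bInf := by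
  rw [S.pVec_eq hx, S.bInf_eq hx, S.cInf_eq hx]
  have := Real.cos_sq_add_sin_sq (angle x)
  match_scalars
  · linear_combination -this
  · ring

theorem orthonormal_objects (y : ℝ) :
    Orthonormal ℝ ![S.uVec 1 y, S.vVec 1 y, S.bInf, S.cInf] := by
  have h := orthonormal_four_rotate (S.orthonormal_adapted one_pos y)
    (c := Real.cos (angle 1)) (s := -Real.sin (angle 1))
    (by rw [neg_sq]; exact Real.cos_sq_add_sin_sq _)
  have hb : S.bInf = Real.cos (angle 1) • S.qVec 1 y + -Real.sin (angle 1) • S.pVec 1 y := by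
    rw [S.qVec_eq one_pos, S.pVec_eq one_pos, bInf]; module
  have hc : S.cInf = Real.cos (angle 1) • S.pVec 1 y - -Real.sin (angle 1) • S.qVec 1 y := by
    rw [S.qVec_eq one_pos, S.pVec_eq one_pos, cInf]; module
  rwa [← hb, ← hc] at h

theorem n_eq {x : ℝ} (hx : 0 < x) (y : ℝ) :
    S.n x y = (kappa x y - 1) • S.vVec 1 y + axisDist x y • S.pVec x y := by
  rw [← S.vVec_eq hx, vVec, pVec]
  have := axisDist_sq_add x y
  match_scalars
  · linear_combination -this
  · ring

theorem mVec_eq {x : ℝ} (hx : 0 < x) (y : ℝ) :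
    S.mVec x y = axisDist x y • S.vVec 1 y - (kappa x y - 1) • S.pVec x y := by
  rw [← S.vVec_eq hx, vVec, pVec]
  have := axisDist_sq_add x y
  match_scalars
  · linear_combination -this
  · ring

theorem Xα_eq (x y : ℝ) :
    S.Xα x y = cosPsi x • S.qVec x y - sinPsi x • S.mVec x y := by
  rw [qVec, mVec]
  have := cosPsi_sq_add_sinPsi_sq x
  match_scalars
  · linear_combination -this
  · ring

theorem ξ_eq (x y : ℝ) :
    S.ξ x y = sinPsi x • S.qVec x y + cosPsi x • S.mVec x y := by
  rw [qVec, mVec]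
  have := cosPsi_sq_add_sinPsi_sq x
  match_scalars
  · linear_combination -this
  · ring

/-! ### The curves `x ↦ n (x, y)` -/

theorem norm_n_add_v_le {x : ℝ} (hx : 0 < x) (y : ℝ) :
    ‖S.n x y + S.vVec 1 y‖ ≤ √(2 * kappa x y) := by
  obtain ⟨⟨-, e2, -, e4⟩, -, ⟨-, e9, -⟩⟩ := orthonormal_four_iff.1 (S.orthonormal_adapted hx y)
  refine Real.le_sqrt_of_sq_le (le_of_eq ?_)
  have e : S.n x y + S.vVec 1 y = kappa x y • S.vVec x y + axisDist x y • S.pVec x y := by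
    rw [S.n_eq hx, S.vVec_eq hx]; module
  rw [e, norm_sq_smul_add_smul e2 e4 e9]
  linear_combination axisDist_sq_add x y

/-- The same quantity that bounds `n + v` measures the deviation of `X⁰_α` and `ξ` from the fixed
plane. -/
theorem norm_mVec_sub_pVec {x : ℝ} (hx : 0 < x) (y : ℝ) :
    ‖S.mVec x y - S.pVec x y‖ = √(2 * kappa x y) := by
  obtain ⟨⟨-, e2, -, e4⟩, -, ⟨-, e9, -⟩⟩ := orthonormal_four_iff.1 (S.orthonormal_adapted hx y)
  rw [eq_comm, Real.sqrt_eq_iff_mul_self_eq (by linarith [kappa_pos x y]) (norm_nonneg _),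
    ← pow_two, eq_comm]
  have e : S.mVec x y - S.pVec x y = axisDist x y • S.vVec x y + (-kappa x y) • S.pVec x y := by
    rw [S.mVec_eq hx, S.vVec_eq hx]; module
  rw [e, norm_sq_smul_add_smul e2 e4 e9]
  linear_combination axisDist_sq_add x y

theorem tendsto_sqrt_kappa (R : ℝ) :
    Tendsto (fun x => √(2 * (2 * (1 + R ^ 2) * (Y x / G x)))) atTop (𝓝 0) := by
  have h := (((tendsto_Y_div_G.const_mul (2 * (1 + R ^ 2))).const_mul 2)).sqrt
  simpa using h

theorem sqrt_kappa_le (x : ℝ) {y R : ℝ} (hy : |y| ≤ R) :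
    √(2 * kappa x y) ≤ √(2 * (2 * (1 + R ^ 2) * (Y x / G x))) :=
  Real.sqrt_le_sqrt (mul_le_mul_of_nonneg_left (kappa_le x hy) zero_le_two)

theorem tendsto_n (y : ℝ) : Tendsto (fun x => S.n x y) atTop (𝓝 (-S.vVec 1 y)) := by
  rw [tendsto_iff_norm_sub_tendsto_zero]
  refine squeeze_zero' (Eventually.of_forall fun _ => norm_nonneg _) ?_ (tendsto_sqrt_kappa |y|)
  filter_upwards [eventually_gt_atTop 0] with x hx
  rw [sub_neg_eq_add]
  exact (S.norm_n_add_v_le hx y).trans (sqrt_kappa_le x le_rfl)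

/-- The component of `n` along the axis is `κ - 1 > -1`. -/
theorem n_ne {x : ℝ} (hx : 0 < x) (y : ℝ) : S.n x y ≠ -S.vVec 1 y := by
  intro h
  obtain ⟨⟨-, e2, -, -⟩, -, ⟨-, e9, -⟩⟩ := orthonormal_four_iff.1 (S.orthonormal_adapted hx y)
  have h1 : inner ℝ (S.vVec x y) (S.n x y) = kappa x y - 1 := by
    rw [S.n_eq hx, ← S.vVec_eq hx, inner_add_right, real_inner_smul_right, real_inner_smul_right,
      e2, e9]; ring
  rw [h, ← S.vVec_eq hx, inner_neg_right, e2] at h1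
  linarith [kappa_pos x y]

theorem exists_windsAround : ∃ m M : ℝ, 0 < m ∧ m ≤ M ∧
    ∀ y : ℝ, WindsAround (fun x => S.n x y) (-S.vVec 1 y) S.bInf S.cInf m M := by
  obtain ⟨m, M, hm, hmM, h⟩ := angle_bounds
  refine ⟨m, M, hm, hmM, fun y => ⟨fun x => 1 - kappa x y, fun x => axisDist x y,
    -- The quarter turn appears because `n` projects onto the direction of `p`, which is ahead of
    -- `q` by a right angle.
    fun x => angle x + Real.pi / 2, fun x hx => ⟨axisDist_pos x y, ?_⟩, fun x x' hx hxx' => ?_⟩⟩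
  · beta_reduce
    rw [S.n_eq (by linarith), S.pVec_eq_circle (by linarith), Real.cos_add_pi_div_two,
      Real.sin_add_pi_div_two]
    module
  · simpa using h x x' hx hxx'

theorem eVariationOn_n (y : ℝ) : eVariationOn (fun x => S.n x y) (Set.Ici 1) = ⊤ := by
  obtain ⟨m, M, hm, -, hang⟩ := angle_bounds
  obtain ⟨c, hc, hr⟩ := exists_pos_div_le_axisDist y
  have hcont : ContinuousOn angle (Set.Ici 1) := fun x hx =>
    (hasDerivAt_angle (zero_lt_one.trans_le hx)).continuousAt.continuousWithinAt
  -- Times of successive half turns; the lower bound `m` for the speed puts the `k`-th one before `1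
  -- + πk/m`.
  have hex : ∀ k : ℕ, ∃ t ∈ Set.Icc (1 : ℝ) (1 + Real.pi * k / m),
      angle t = angle 1 + k * Real.pi := fun k => by
    have hk : 0 ≤ Real.pi * k / m := by positivity
    have h1 := (hang 1 (1 + Real.pi * k / m) le_rfl (by linarith)).1
    have h2 : m * (1 + Real.pi * k / m - 1) = k * Real.pi := by field_simp; ring
    exact intermediate_value_Icc (by linarith) (hcont.mono Set.Icc_subset_Ici_self)
      ⟨by have := Real.pi_pos; have : 0 ≤ k * Real.pi := by positivity
          linarith, by linarith⟩
  choose t ht hta using hex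
  have hmono : Monotone t := monotone_nat_of_le_succ fun k => by
    by_contra hlt
    have h1 := (hang (t (k + 1)) (t k) (ht _).1 (not_le.1 hlt).le).1
    rw [hta, hta] at h1
    push_cast at h1
    nlinarith [mul_pos hm (sub_pos.2 (not_le.1 hlt)), Real.pi_pos]
  have hpos : ∀ k, 0 < t k := fun k => zero_lt_one.trans_le (ht k).1
  set C := c / (1 + Real.pi / m)
  have hC : 0 < C := by have := Real.pi_pos; positivity
  have hproj : ∀ k, inner ℝ (S.pVec 1 0) (S.n (t k) y) = (-1) ^ k * axisDist (t k) y := fun k => by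
    obtain ⟨⟨-, -, -, e4⟩, -, ⟨-, e9, e10⟩⟩ :=
      orthonormal_four_iff.1 (S.orthonormal_adapted one_pos y)
    have hp : S.pVec (t k) y = (-1 : ℝ) ^ k • S.pVec 1 y := by
      rw [S.pVec_eq_circle (hpos k), S.pVec_eq_circle one_pos, hta, Real.cos_add_nat_mul_pi,
        Real.sin_add_nat_mul_pi]
      module
    rw [S.n_eq (hpos k), hp, ← S.pVec_eq one_pos y, inner_add_right, real_inner_smul_right,
      real_inner_smul_right, real_inner_smul_right, e4, real_inner_comm, e9]
    ring
  -- Between consecutive half turns the component along the fixed vector `p(1)` changes sign, so the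
  -- two axis distances add up and the chord is at least a multiple of `1/(k + 1)`.
  have hdist : ∀ k : ℕ, C * (1 / ((k : ℝ) + 1)) ≤ dist (S.n (t (k + 1)) y) (S.n (t k) y) := by
    intro k
    have h1 : |inner ℝ (S.pVec 1 0) (S.n (t (k + 1)) y - S.n (t k) y)| ≤
        dist (S.n (t (k + 1)) y) (S.n (t k) y) := by
      have h2 := abs_real_inner_le_norm (S.pVec 1 0) (S.n (t (k + 1)) y - S.n (t k) y)
      have h3 : ‖S.pVec 1 0‖ = 1 := (S.orthonormal_adapted one_pos 0).1 3
      rwa [h3, one_mul, ← dist_eq_norm] at h2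
    refine le_trans ?_ h1
    have h4 : (-1 : ℝ) ^ (k + 1) * axisDist (t (k + 1)) y - (-1) ^ k * axisDist (t k) y =
      (-1) ^ (k + 1) * (axisDist (t (k + 1)) y + axisDist (t k) y) := by ring
    rw [inner_sub_right, hproj, hproj, h4, abs_mul, abs_pow, abs_neg, abs_one, one_pow, one_mul]
    refine le_trans ?_ (le_abs_self _)
    have h5 := axisDist_pos (t (k + 1)) y
    have h6 := hr (t k) (ht k).1
    have h7 : C * (1 / ((k : ℝ) + 1)) ≤ c / t k := by
      rw [mul_one_div, div_div]
      have := Real.pi_pos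
      have h8 := hpos k
      refine div_le_div_of_nonneg_left hc.le h8 ((ht k).2.trans ?_)
      have : 0 ≤ Real.pi / m := by positivity
      rw [mul_div_right_comm]
      nlinarith [(Nat.cast_nonneg k : (0 : ℝ) ≤ k)]
    linarith
  rw [eq_top_iff]
  refine le_of_tendsto' (f := fun N : ℕ => ENNReal.ofReal (∑ i ∈ Finset.range N,
    C * (1 / ((i : ℝ) + 1)))) (x := atTop) ?_ fun N => ?_
  · refine ENNReal.tendsto_ofReal_nhds_top.2 ?_
    simp_rw [← Finset.mul_sum]
    exact Real.tendsto_sum_range_one_div_nat_succ_atTop.const_mul_atTop hC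
  · refine le_trans ?_ (eVariationOn.sum_le (n := N) hmono fun i => (ht i).1)
    rw [ENNReal.ofReal_sum_of_nonneg fun i _ => by positivity]
    refine Finset.sum_le_sum fun i _ => ?_
    rw [edist_dist]
    exact ENNReal.ofReal_le_ofReal (hdist i)

/-! ### The position vector -/

theorem radius_smul_unitF (x y : ℝ) :
    radius y • S.unitF x y = (2 * √5)⁻¹ • ((√(1 + y ^ 2))⁻¹ • S.n x y + (2 : ℝ) • -S.ξ x y) := by
  have hs := sqrt_pos' y
  have h1 : 0 < √(5 + 4 * y ^ 2) := Real.sqrt_pos.2 (by positivity)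
  rw [unitF, n, radius, Real.sqrt_mul (by positivity), Real.sqrt_div (by positivity)]
  have h2 := sq_sqrt' y
  set s := √(1 + y ^ 2)
  rw [← h2]
  match_scalars <;> field_simp

/-- The centre of the sphere containing `x ↦ f (x, y)`. -/
noncomputable def centre (y : ℝ) : E4 := S.f (1, y) - radius y • S.unitF 1 y

/-- The two sides have the same `x`-derivative because `c₁ - 2b₁ = 2√5 (x² - y²)/(x h)`. -/
theorem f_eq {x : ℝ} (hx : 0 < x) (y : ℝ) :
    S.f (x, y) = radius y • S.unitF x y + S.centre y := by
  have h : ∀ x, 0 < x → HasDerivAt (fun x => S.f (x, y) - radius y • S.unitF x y) 0 x := by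
    intro x hx
    have h1 := (S.df (x, y) hx).comp_hasDerivAt x
      ((hasDerivAt_id x).prodMk (hasDerivAt_const x y))
    have h2 := ((((S.hasDerivAt_n_fst hx y).const_smul (√(1 + y ^ 2))⁻¹).add
      ((S.hasDerivAt_ξ_fst hx y).neg.const_smul (2 : ℝ))).const_smul (2 * √5)⁻¹)
    simp_rw [S.radius_smul_unitF]
    refine (h1.sub h2).congr_deriv ?_
    have hs := sqrt_pos' y
    have hh := hG_pos x y
    simp only [add_apply, ContinuousLinearMap.smulRight_apply,
      ContinuousLinearMap.coe_fst', ContinuousLinearMap.coe_snd', zero_smul, add_zero, one_smul,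
      h_eq hx, c₁_eq hx, b₁_eq hx, Xα]
    match_scalars
    field_simp
    ring
  have h3 := eq_of_hasDerivAt_zero h hx one_pos
  rw [centre, ← h3]; abel

theorem f_mem_sphereY {x : ℝ} (hx : 0 < x) (y : ℝ) :
    S.f (x, y) ∈ sphereY (S.uVec 1) S.centre y := by
  obtain ⟨⟨-, e2, -, e4⟩, ⟨-, -, -⟩, ⟨e8, e9, e10⟩⟩ :=
    orthonormal_four_iff.1 (S.orthonormal_u_n hx y)
  rw [sphereY, Set.mem_ofPred_eq, S.f_eq hx, add_sub_cancel_right, S.radius_smul_unitF,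
    ← S.uVec_eq hx]
  constructor
  · rw [real_inner_smul_left, inner_add_left, real_inner_smul_left, real_inner_smul_left,
      inner_neg_left, e8, real_inner_comm, e10]
    ring
  · refine norm_smul_eq_radius e4 ?_ ?_ y
    · rw [inner_neg_neg, e2]
    · rw [inner_neg_right, real_inner_comm, e9, neg_zero]

/-- `‖X⁰_α - q‖` depends on `ψ(x)` alone, which gives uniformity in `y`, and `ψ(0) = 0`; the vector
`q` itself is exactly on the circle at phase `angle`. -/
theorem tendsto_Xα_zero : TendstoUniformly
    (fun s y : ℝ => S.Xα (Real.exp (-s)) y -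
      (Real.cos (√5 * s / 2) • S.bInf - Real.sin (√5 * s / 2) • S.cInf))
    (fun _ => (0 : E4)) atTop := by
  obtain ⟨⟨-, -, e3, e4⟩, -, -⟩ := orthonormal_four_iff.1 (S.orthonormal_objects 0)
  have hb : ‖S.bInf‖ = 1 := (S.orthonormal_objects 0).1 2
  have hc : ‖S.cInf‖ = 1 := (S.orthonormal_objects 0).1 3
  rw [← tendstoUniformlyOn_univ]
  refine tendstoUniformlyOn_zero_of_norm_le (b := fun s => √(2 - 2 * cosPsi (Real.exp (-s))) +
    2 * |angle (Real.exp (-s)) + √5 * s / 2|) (Eventually.of_forall fun s y _ => ?_) ?_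
  · have hx := Real.exp_pos (-s)
    set x := Real.exp (-s)
    have h1 : ‖S.Xα x y - S.qVec x y‖ ≤ √(2 - 2 * cosPsi x) := by
      refine Real.le_sqrt_of_sq_le (le_of_eq ?_)
      have e : S.Xα x y - S.qVec x y = (1 - cosPsi x) • S.Xα x y + (-sinPsi x) • S.ξ x y := by
        rw [qVec]; module
      obtain ⟨⟨f1, f2, -, -⟩, ⟨f3, -, -⟩, -⟩ := orthonormal_four_iff.1 (S.orthonormal_u_n hx y)
      rw [e, norm_sq_smul_add_smul f1 f2 f3]
      linear_combination cosPsi_sq_add_sinPsi_sq x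
    have h2 : Real.cos (√5 * s / 2) • S.bInf - Real.sin (√5 * s / 2) • S.cInf =
        Real.cos (-(√5 * s / 2)) • S.bInf + Real.sin (-(√5 * s / 2)) • S.cInf := by
      rw [Real.cos_neg, Real.sin_neg]; module
    have h3 := norm_circle_sub_le hb hc (angle x) (-(√5 * s / 2))
    rw [← S.qVec_eq_circle hx y, ← h2, sub_neg_eq_add] at h3
    exact (norm_sub_le_norm_sub_add_norm_sub _ (S.qVec x y) _).trans (add_le_add h1 h3)
  · have h1 := ((differentiable_cosPsi.continuous.tendsto 0).comp
      Real.tendsto_exp_neg_atTop_nhds_zero)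
    have h2 := ((h1.const_mul 2).const_sub 2).sqrt.add (tendsto_angle_zero.abs.const_mul 2)
    simpa [cosPsi_zero] using h2

theorem associatedObjects :
    AssociatedObjects S (S.uVec 1) (S.vVec 1) S.centre S.bInf S.cInf where
  u_eq _ y hx := (S.uVec_eq hx y).symm
  v₁_continuous := S.continuous_vVec_snd one_pos
  u_deriv y := S.hasDerivAt_uVec_snd one_pos y
  f_eq _ y hx := S.f_eq hx y
  f_mem_sphere _ y hx := S.f_mem_sphereY hx y
  orthonormal := S.orthonormal_objects
  tendsto_zero := S.tendsto_Xα_zero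

/-! ### The limit circles -/

/-- `b̂` for a given phase -/
noncomputable def bHat (δ : ℝ) : E4 := Real.cos δ • S.cInf - Real.sin δ • S.bInf

/-- `ĉ` for a given phase -/
noncomputable def cHat (δ : ℝ) : E4 := Real.cos δ • S.bInf + Real.sin δ • S.cInf

theorem bBar_eq (δ x : ℝ) : bBar (S.bHat δ) (S.cHat δ) x =
    Real.cos (w x + δ) • S.cInf + Real.sin (w x + δ) • -S.bInf := by
  rw [bBar, bHat, cHat, Real.cos_add, Real.sin_add]; module

theorem cBar_eq (δ x : ℝ) : cBar (S.bHat δ) (S.cHat δ) x =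
    Real.cos (w x + δ) • S.bInf + Real.sin (w x + δ) • S.cInf := by
  rw [cBar, bHat, cHat, Real.cos_add, Real.sin_add]; module

theorem orthonormal_hat (δ : ℝ) : Orthonormal ℝ ![S.bHat δ, S.cHat δ] := by
  have h := orthonormal_four_rotate (S.orthonormal_objects 0) (Real.cos_sq_add_sin_sq δ)
  have h1 := h.comp ![3, 2] (by decide)
  convert h1 using 1
  ext1 j
  fin_cases j <;> rfl

theorem span_hat (δ : ℝ) :
    Submodule.span ℝ {S.bHat δ, S.cHat δ} = Submodule.span ℝ {S.bInf, S.cInf} := by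
  have h := Real.cos_sq_add_sin_sq δ
  apply le_antisymm <;> rw [Submodule.span_le] <;> rintro z (rfl | rfl) <;>
    rw [SetLike.mem_coe, Submodule.mem_span_pair]
  · exact ⟨-Real.sin δ, Real.cos δ, by rw [bHat]; module⟩
  · exact ⟨Real.cos δ, Real.sin δ, by rw [cHat]⟩
  · refine ⟨-Real.sin δ, Real.cos δ, ?_⟩
    rw [bHat, cHat]
    match_scalars
    · ring
    · linear_combination h
  · refine ⟨Real.cos δ, Real.sin δ, ?_⟩
    rw [bHat, cHat]
    match_scalars
    · linear_combination h
    · ring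

/-- Two errors: replacing `m` by `p` costs `√(2κ)`, and replacing the phase `angle - ψ` by `w + δ`
costs the second term. -/
theorem norm_ξ_sub_bBar_le (δ : ℝ) {x : ℝ} (hx : 0 < x) (y : ℝ) :
    ‖S.ξ x y - bBar (S.bHat δ) (S.cHat δ) x‖ ≤
      √(2 * kappa x y) + 2 * |angle x - psi x - w x - δ| := by
  have hb : ‖-S.bInf‖ = 1 := by rw [norm_neg]; exact (S.orthonormal_objects 0).1 2
  have hc : ‖S.cInf‖ = 1 := (S.orthonormal_objects 0).1 3
  have h1 := norm_circle_sub_le hc hb (angle x - psi x) (w x + δ)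
  rw [← S.bBar_eq, ← sub_sub] at h1
  have h2 : ‖S.ξ x y - (Real.cos (angle x - psi x) • S.cInf +
      Real.sin (angle x - psi x) • -S.bInf)‖ ≤ √(2 * kappa x y) := by
    have e : S.ξ x y - (Real.cos (angle x - psi x) • S.cInf +
        Real.sin (angle x - psi x) • -S.bInf) = cosPsi x • (S.mVec x y - S.pVec x y) := by
      rw [S.ξ_eq, S.qVec_eq_circle hx, S.pVec_eq_circle hx, Real.cos_sub, Real.sin_sub, cos_psi,
        sin_psi]
      module
    rw [e, norm_smul, S.norm_mVec_sub_pVec hx]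
    refine mul_le_of_le_one_left (Real.sqrt_nonneg _) ?_
    rw [← cos_psi]; exact Real.abs_cos_le_one _
  exact (norm_sub_le_norm_sub_add_norm_sub _ _ _).trans (add_le_add h2 h1)

theorem norm_Xα_sub_cBar_le (δ : ℝ) {x : ℝ} (hx : 0 < x) (y : ℝ) :
    ‖S.Xα x y - cBar (S.bHat δ) (S.cHat δ) x‖ ≤
      √(2 * kappa x y) + 2 * |angle x - psi x - w x - δ| := by
  have hb : ‖S.bInf‖ = 1 := (S.orthonormal_objects 0).1 2
  have hc : ‖S.cInf‖ = 1 := (S.orthonormal_objects 0).1 3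
  have h1 := norm_circle_sub_le hb hc (angle x - psi x) (w x + δ)
  rw [← S.cBar_eq, ← sub_sub] at h1
  have h2 : ‖S.Xα x y - (Real.cos (angle x - psi x) • S.bInf +
      Real.sin (angle x - psi x) • S.cInf)‖ ≤ √(2 * kappa x y) := by
    have e : S.Xα x y - (Real.cos (angle x - psi x) • S.bInf +
        Real.sin (angle x - psi x) • S.cInf) = (-sinPsi x) • (S.mVec x y - S.pVec x y) := by
      rw [S.Xα_eq, S.qVec_eq_circle hx, S.pVec_eq_circle hx, Real.cos_sub, Real.sin_sub, cos_psi,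
        sin_psi]
      module
    rw [e, norm_smul, S.norm_mVec_sub_pVec hx, norm_neg]
    refine mul_le_of_le_one_left (Real.sqrt_nonneg _) ?_
    rw [← sin_psi]; exact Real.abs_sin_le_one _
  exact (norm_sub_le_norm_sub_add_norm_sub _ _ _).trans (add_le_add h2 h1)

theorem limitCircle_sub_centre (δ x y : ℝ) :
    limitCircle (S.vVec 1) S.centre (S.bHat δ) (S.cHat δ) x y - S.centre y =
      (2 * √5)⁻¹ • ((√(1 + y ^ 2))⁻¹ • -S.vVec 1 y +
        (2 : ℝ) • -bBar (S.bHat δ) (S.cHat δ) x) := by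
  have hs := sqrt_pos' y
  rw [limitCircle, add_sub_cancel_right]
  match_scalars <;> field_simp

theorem limitCircle_mem_sphereY (δ x y : ℝ) :
    limitCircle (S.vVec 1) S.centre (S.bHat δ) (S.cHat δ) x y ∈
      sphereY (S.uVec 1) S.centre y := by
  have h := orthonormal_four_rotate (S.orthonormal_objects y) (Real.cos_sq_add_sin_sq (w x + δ))
  have hb : bBar (S.bHat δ) (S.cHat δ) x =
      Real.cos (w x + δ) • S.cInf - Real.sin (w x + δ) • S.bInf := by rw [bBar_eq]; module
  rw [← hb] at h
  obtain ⟨⟨-, e2, -, e4⟩, ⟨e5, -, e7⟩, ⟨-, e9, -⟩⟩ := orthonormal_four_iff.1 h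
  rw [sphereY, Set.mem_ofPred_eq, limitCircle_sub_centre]
  constructor
  · rw [real_inner_comm, real_inner_smul_right, inner_add_right, real_inner_smul_right,
      real_inner_smul_right, inner_neg_right, inner_neg_right, e5, e7]
    ring
  · refine norm_smul_eq_radius ?_ ?_ ?_ y
    · rw [inner_neg_neg, e2]
    · rw [inner_neg_neg, e4]
    · rw [inner_neg_neg, e9]

theorem norm_f_sub_limitCircle_le (δ : ℝ) {x : ℝ} (hx : 0 < x) (y : ℝ) :
    ‖S.f (x, y) - limitCircle (S.vVec 1) S.centre (S.bHat δ) (S.cHat δ) x y‖ ≤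
      3 * √(2 * kappa x y) + 4 * |angle x - psi x - w x - δ| := by
  have e : S.f (x, y) - limitCircle (S.vVec 1) S.centre (S.bHat δ) (S.cHat δ) x y =
      (2 * √5)⁻¹ • ((√(1 + y ^ 2))⁻¹ • (S.n x y + S.vVec 1 y) -
        (2 : ℝ) • (S.ξ x y - bBar (S.bHat δ) (S.cHat δ) x)) := by
    rw [S.f_eq hx, S.radius_smul_unitF, ← sub_add_cancel
      (limitCircle (S.vVec 1) S.centre (S.bHat δ) (S.cHat δ) x y) (S.centre y),
      limitCircle_sub_centre]
    module
  have h5 : (2 * √5)⁻¹ ≤ 1 := inv_le_one_of_one_le₀ (by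
    have : 1 ≤ √5 := Real.one_le_sqrt.2 (by norm_num)
    linarith)
  have hs : (√(1 + y ^ 2))⁻¹ ≤ 1 := inv_le_one_of_one_le₀ (Real.one_le_sqrt.2 (by nlinarith))
  rw [e, norm_smul, Real.norm_of_nonneg (by positivity)]
  refine (mul_le_of_le_one_left (norm_nonneg _) h5).trans ((norm_sub_le _ _).trans ?_)
  rw [norm_smul, norm_smul, Real.norm_of_nonneg (by positivity), Real.norm_ofNat]
  have h1 := (mul_le_of_le_one_left (norm_nonneg _) hs).trans (S.norm_n_add_v_le hx y)
  linarith [S.norm_ξ_sub_bBar_le δ hx y]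

theorem tendstoUniformlyOn_zero_of_le {F : ℝ → ℝ → E4} {δ a b : ℝ} (ha : 0 ≤ a)
    (hδ : Tendsto (fun x => angle x - psi x - w x) atTop (𝓝 δ))
    (hF : ∀ x y, 0 < x →
      ‖F x y‖ ≤ a * √(2 * kappa x y) + b * |angle x - psi x - w x - δ|)
    {K : Set ℝ} (hK : IsCompact K) : TendstoUniformlyOn F (fun _ => 0) atTop K := by
  obtain ⟨R, hR⟩ := hK.isBounded.exists_norm_le
  refine tendstoUniformlyOn_zero_of_norm_le ((eventually_gt_atTop 0).mono fun x hx y hy =>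
    (hF x y hx).trans (add_le_add_left (mul_le_mul_of_nonneg_left
      (sqrt_kappa_le x (hR y hy)) ha) _)) ?_
  have h := ((tendsto_sqrt_kappa R).const_mul a).add (((hδ.sub_const δ).abs).const_mul b)
  simpa using h

end CurvatureSurface

end ConfFlat

theorem mainTheorem7 (S : ConfFlat.CurvatureSurface) :
    ∃ (u v₁ A : ℝ → ConfFlat.E4) (bInf cInf : ConfFlat.E4),
      ConfFlat.AssociatedObjects S u v₁ A bInf cInf ∧
      (∀ y : ℝ, eVariationOn (fun x => S.n x y) (Set.Ici 1) = ⊤) ∧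
      (∀ y : ℝ, Tendsto (fun x => S.n x y) atTop (𝓝 (-v₁ y))) ∧
      (∃ m M : ℝ, 0 < m ∧ m ≤ M ∧
        ∀ y : ℝ, ConfFlat.WindsAround (fun x => S.n x y) (-v₁ y) bInf cInf m M) ∧
      (∀ x y : ℝ, 0 < x → S.n x y ≠ -v₁ y) ∧
      ∃ bHat cHat : ConfFlat.E4,
        Orthonormal ℝ ![bHat, cHat] ∧
        Submodule.span ℝ {bHat, cHat} = Submodule.span ℝ {bInf, cInf} ∧
        (∀ K : Set ℝ, IsCompact K →
          TendstoUniformlyOn (fun x y : ℝ => S.ξ x y - ConfFlat.bBar bHat cHat x)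
            (fun _ => 0) atTop K ∧
          TendstoUniformlyOn (fun x y : ℝ => S.Xα x y - ConfFlat.cBar bHat cHat x)
            (fun _ => 0) atTop K) ∧
        (∀ x y : ℝ, ConfFlat.limitCircle v₁ A bHat cHat x y ∈ ConfFlat.sphereY u A y) ∧
        (∀ K : Set ℝ, IsCompact K →
          TendstoUniformlyOn
            (fun x y : ℝ => S.f (x, y) - ConfFlat.limitCircle v₁ A bHat cHat x y)
            (fun _ => 0) atTop K) := by
  -- The limiting phase difference `δ` fixes the basis `b̂, ĉ`.
  obtain ⟨δ, hδ⟩ := ConfFlat.exists_tendsto_angle_sub_psi_sub_w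
  refine ⟨S.uVec 1, S.vVec 1, S.centre, S.bInf, S.cInf, S.associatedObjects, S.eVariationOn_n,
    S.tendsto_n, S.exists_windsAround, fun x y hx => S.n_ne hx y, S.bHat δ, S.cHat δ,
    S.orthonormal_hat δ, S.span_hat δ, fun K hK => ⟨?_, ?_⟩, S.limitCircle_mem_sphereY δ,
    fun K hK => ?_⟩
  · exact ConfFlat.CurvatureSurface.tendstoUniformlyOn_zero_of_le zero_le_one hδ
      (fun x y hx => by rw [one_mul]; exact S.norm_ξ_sub_bBar_le δ hx y) hK
  · exact ConfFlat.CurvatureSurface.tendstoUniformlyOn_zero_of_le zero_le_one hδ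
      (fun x y hx => by rw [one_mul]; exact S.norm_Xα_sub_cBar_le δ hx y) hK
  · exact ConfFlat.CurvatureSurface.tendstoUniformlyOn_zero_of_le zero_le_three hδ
      (fun x y hx => S.norm_f_sub_limitCircle_le δ hx y) hK
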